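/- Let $k$ be a field of characteristic $0$. Let $\mathcal F$ be the free nonsymmetric $k$-linear operad generated by two binary operations $\bullet$ and $\circ$. Let $\mathcal F(3)_{12}$ be the span of $(x\circ y)\bullet z$ and $x\bullet(y\circ z)$, and let $\mathcal F(3)_{21}$ be the span of $(x\bullet y)\circ z$ and $x\circ(y\bullet z)$. For a linear map $D\colon \mathcal F(3)_{12}\to\mathcal F(3)_{21}$, let $\mathcal P_D$ be the quotient of $\mathcal F$ by the operad ideal generated by the associators $(x\bullet y)\bullet z-x\bullet(y\bullet z)$ and $(x\circ y)\circ z-x\circ(y\circ z)$ and by all elements $u-D(u)$ with $u\in\mathcal F(3)_{12}$. Let $\mathcal P_1$ and $\mathcal P_2$ be the nonsymmetric operads presented by one associative binary operation, $\bullet$ and $\circ$ respectively, with their canonical morphisms to $\mathcal P_D$. Call $D$ a (nonsymmetric) distributive law between two associative multiplications if for every $n\ge 2$ the map $$\xi(n)\colon \bigoplus_{l\ge 1}\ \bigoplus_{m_1+\cdots+m_l=n,\ m_s\ge 1}\mathcal P_2(l)\otimes\mathcal P_1(m_1)\otimes\cdots\otimes\mathcal P_1(m_l)\longrightarrow\mathcal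 P_D(n),\qquad \mu\otimes\nu_1\otimes\cdots\otimes\nu_l\mapsto\mu(\nu_1,\dots,\nu_l),$$ is an isomorphism. Then $D$ is a distributive law if and only if, written as a rewrite rule $u=D(u)$, it is one of (a) $(x\circ y)\bullet z=0$, $\ x\bullet(y\circ z)=0$; (b) $(x\circ y)\bullet z=0$, $\ x\bullet(y\circ z)=(x\bullet y)\circ z$; (c) $(x\circ y)\bullet z=x\circ(y\bullet z)$, $\ x\bullet(y\circ z)=0$; (d) $(x\circ y)\bullet z=x\circ(y\bullet z)$, $\ x\bullet(y\circ z)=(x\bullet y)\circ z$. In particular there are exactly four distributive laws. Moreover, let $a,b,c,d$ be indeterminates and consider the four relations $$\begin{aligned} \alpha_1(x,y,z)&=(x\circ y)\circ z-x\circ(y\circ z),\\ \alpha_2(x,y,z)&=(x\bullet y)\bullet z-x\bullet(y\bullet z),\\ \beta_1(x,y,z)&=(x\circ y)\bullet z+a\,(x\bullet y)\circ z+b\,x\circ(y\bullet z),\\ \beta_2(x,y,z)&=x\bullet(y\circ z)+c\,(x\bullet y)\circ z+d\,x\circ(y\bullet z). \end{aligned}$$ Let $[RR]$ be the $40\times 40$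 matrix over $k[a,b,c,d]$ whose rows are the consequences $\rho(w\star x,y,z)$, $\rho(w,x\star y,z)$, $\rho(w,x,y\star z)$, $\rho(w,x,y)\star z$, $w\star\rho(x,y,z)$, for $\star\in\{\circ,\bullet\}$ and $\rho\in\{\alpha_1,\alpha_2,\beta_1,\beta_2\}$, expanded in the $40$ nonsymmetric monomials of arity $4$ in $\circ,\bullet$. Then, for all values $a,b,c,d\in k$, the map $D$ given by $(x\circ y)\bullet z\mapsto -a\,(x\bullet y)\circ z-b\,x\circ(y\bullet z)$ and $x\bullet(y\circ z)\mapsto -c\,(x\bullet y)\circ z-d\,x\circ(y\bullet z)$ is a distributive law if and only if the matrix $[RR]$ evaluated at $(a,b,c,d)$ has rank $32$. -/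

import Mathlib

noncomputable section

namespace NSOp

universe u v w

/-! ### Planar binary trees and free nonsymmetric operads on binary generators -/

/-- Planar rooted binary trees with inner vertices labelled by `α`, that is, nonsymmetric monomials
in the binary operations `α` (the variables being read off from left to right). -/
inductive BTree (α : Type u) : Type u
  | leaf : BTree α
  | node : α → BTree α → BTree α → BTree α

namespace BTree

/-- Number of leaves (the arity of the monomial). -/
def leaves {α : Type u} : BTree α → ℕ
  | leaf => 1
  | node _ s t => s.leaves + t.leaves

/-- Relabelling of the vertices. -/
def map {α : Type u} {β : Type v} (f : α → β) : BTree α → BTree β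
  | leaf => leaf
  | node a s t => node (f a) (s.map f) (t.map f)

theorem leaves_map {α : Type u} {β : Type v} (f : α → β) (t : BTree α) :
    (t.map f).leaves = t.leaves := by
  induction t with
  | leaf => rfl
  | node a s t hs ht => simp [map, leaves, hs, ht]

end BTree

/-- Trees with exactly `n` leaves. -/
abbrev TreeN (α : Type u) (n : ℕ) : Type u := {t : BTree α // t.leaves = n}

/-- The linear span of all trees: the direct sum of all components of the free nonsymmetric operad
generated by the vector space with basis `α` placed in arity `2`. -/
abbrev Total (R : Type w) [CommRing R] (α : Type u) : Type (max u w) := BTree α →₀ R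

/-- The arity `n` component of the free nonsymmetric operad generated by the vector space
with basis `α` placed in arity `2`. -/
abbrev Free (R : Type w) [CommRing R] (α : Type u) (n : ℕ) : Type (max u w) := TreeN α n →₀ R

section FreeOperad

variable (R : Type w) [CommRing R] {α : Type u} {β : Type v}

/-- Inclusion of the arity `n` component in the sum of all components. -/
def incl (n : ℕ) : Free R α n →ₗ[R] Total R α := Finsupp.lmapDomain R R Subtype.val

/-- Projection of the sum of all components to the arity `n` component. -/
def proj (n : ℕ) : Total R α →ₗ[R] Free R α n := Finsupp.lsubtypeDomain {t : BTree α | t.leaves = n}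

/-- The bilinear operation `(s, t) ↦ s a t` belonging to the generator `a`. -/
def mul (a : α) : Total R α →ₗ[R] Total R α →ₗ[R] Total R α :=
  Finsupp.linearCombination R fun s : BTree α =>
    Finsupp.linearCombination R fun t : BTree α => Finsupp.single (BTree.node a s t) (1 : R)

/-- Substitution into the monomial `t`: the `i`-th leaf is replaced by `x i`. -/
def substFun : (t : BTree α) → (Fin t.leaves → Total R α) → Total R α
  | .leaf, x => x (0 : Fin 1)
  | .node a s t, x =>
      mul R a (substFun s fun i => x (Fin.castAdd t.leaves i))
        (substFun t fun i => x (Fin.natAdd s.leaves i))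

variable {R}

theorem update_castAdd {M : Type*} {m n : ℕ} (x : Fin (m + n) → M) (i : Fin m) (y : M) :
    (fun j => Function.update x (Fin.castAdd n i) y (Fin.castAdd n j)) =
        Function.update (fun j => x (Fin.castAdd n j)) i y ∧
      (fun j => Function.update x (Fin.castAdd n i) y (Fin.natAdd m j)) =
        fun j => x (Fin.natAdd m j) := by
  constructor <;> funext j
  · by_cases h : j = i
    · subst h; simp
    · rw [Function.update_of_ne h, Function.update_of_ne]
      simpa [Fin.ext_iff] using h
  · rw [Function.update_of_ne]
    simp only [ne_eq, Fin.ext_iff, Fin.val_natAdd, Fin.val_castAdd]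
    omega

theorem update_natAdd {M : Type*} {m n : ℕ} (x : Fin (m + n) → M) (i : Fin n) (y : M) :
    (fun j => Function.update x (Fin.natAdd m i) y (Fin.natAdd m j)) =
        Function.update (fun j => x (Fin.natAdd m j)) i y ∧
      (fun j => Function.update x (Fin.natAdd m i) y (Fin.castAdd n j)) =
        fun j => x (Fin.castAdd n j) := by
  constructor <;> funext j
  · by_cases h : j = i
    · subst h; simp
    · rw [Function.update_of_ne h, Function.update_of_ne]
      simpa [Fin.ext_iff] using h
  · rw [Function.update_of_ne]
    simp only [ne_eq, Fin.ext_iff, Fin.val_natAdd, Fin.val_castAdd]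
    omega

theorem substFun_add (t : BTree α) (x : Fin t.leaves → Total R α) (i : Fin t.leaves)
    (y z : Total R α) :
    substFun R t (Function.update x i (y + z)) =
      substFun R t (Function.update x i y) + substFun R t (Function.update x i z) := by
  induction t with
  | leaf =>
    change Fin 1 at i
    obtain rfl : i = 0 := Subsingleton.elim _ _
    simp only [substFun]
    erw [Function.update_self, Function.update_self, Function.update_self]
  | node a s t hs ht =>
    simp only [substFun]
    change Fin (s.leaves + t.leaves) at i
    change Fin (s.leaves + t.leaves) → _ at x
    induction i using Fin.addCases with
    | left i =>
      erw [(update_castAdd x i (y + z)).1, (update_castAdd x i (y + z)).2,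
        (update_castAdd x i y).1, (update_castAdd x i y).2,
        (update_castAdd x i z).1, (update_castAdd x i z).2, hs]
      simp
    | right i =>
      erw [(update_natAdd x i (y + z)).1, (update_natAdd x i (y + z)).2,
        (update_natAdd x i y).1, (update_natAdd x i y).2,
        (update_natAdd x i z).1, (update_natAdd x i z).2, ht]
      simp

theorem substFun_smul (t : BTree α) (x : Fin t.leaves → Total R α) (i : Fin t.leaves)
    (c : R) (y : Total R α) :
    substFun R t (Function.update x i (c • y)) = c • substFun R t (Function.update x i y) := by
  induction t with
  | leaf =>
    change Fin 1 at i
    obtain rfl : i = 0 := Subsingleton.elim _ _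
    simp only [substFun]
    erw [Function.update_self, Function.update_self]
  | node a s t hs ht =>
    simp only [substFun]
    change Fin (s.leaves + t.leaves) at i
    change Fin (s.leaves + t.leaves) → _ at x
    induction i using Fin.addCases with
    | left i =>
      erw [(update_castAdd x i (c • y)).1, (update_castAdd x i (c • y)).2,
        (update_castAdd x i y).1, (update_castAdd x i y).2, hs]
      simp
    | right i =>
      erw [(update_natAdd x i (c • y)).1, (update_natAdd x i (c • y)).2,
        (update_natAdd x i y).1, (update_natAdd x i y).2, ht]
      simp

variable (R)

/-- Substitution into the monomial `t`, as a multilinear map. -/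
def subst (t : BTree α) : MultilinearMap R (fun _ : Fin t.leaves => Total R α) (Total R α) where
  toFun := substFun R t
  map_update_add' {inst} x i y z := by
    obtain rfl : inst = instDecidableEqFin _ := Subsingleton.elim _ _
    exact substFun_add t x i y z
  map_update_smul' {inst} x i c y := by
    obtain rfl : inst = instDecidableEqFin _ := Subsingleton.elim _ _
    exact substFun_smul t x i c y

/-- The structure operation
`(μ, (ν₁, …, ν_l)) ↦ μ(ν₁, …, ν_l)`, `Free l × Free m₁ × ⋯ × Free m_l → Free n`, of the free
nonsymmetric operad, where `n = m₁ + ⋯ + m_l` (for all other `n` the map below is zero). -/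
def comp {l : ℕ} (m : Fin l → ℕ) (n : ℕ) :
    Free R α l →ₗ[R] MultilinearMap R (fun i => Free R α (m i)) (Free R α n) :=
  Finsupp.linearCombination R fun t : TreeN α l =>
    (proj R n).compMultilinearMap
      (((subst R t.1).domDomCongr (finCongr t.2)).compLinearMap fun i => incl R (m i))

/-- The morphism of free operads induced by a map between the bases of generators. -/
def freeMap (f : α → β) (n : ℕ) : Free R α n →ₗ[R] Free R β n :=
  Finsupp.lmapDomain R R fun t : TreeN α n => ⟨t.1.map f, (BTree.leaves_map f t.1).trans t.2⟩

/-- The corresponding map between the sums of all components. -/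
def totalMap (f : α → β) : Total R α →ₗ[R] Total R β := Finsupp.lmapDomain R R (BTree.map f)

variable {R}

theorem totalMap_mul (f : α → β) (a : α) (x y : Total R α) :
    totalMap R f (mul R a x y) = mul R (f a) (totalMap R f x) (totalMap R f y) := by
  have h : ((mul R a).compr₂ (totalMap R f)) =
      (mul R (f a)).compl₁₂ (totalMap R f) (totalMap R f) := by
    ext s t : 4
    simp [mul, totalMap, BTree.map]
  exact LinearMap.congr_fun₂ h x y

theorem totalMap_substFun (f : α → β) (t : BTree α) (x : Fin t.leaves → Total R α) :
    totalMap R f (substFun R t x) =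
      substFun R (t.map f) fun i => totalMap R f (x (finCongr (BTree.leaves_map f t) i)) := by
  induction t with
  | leaf => rfl
  | node a s t hs ht =>
    simp only [substFun, BTree.map]
    rw [totalMap_mul, hs, ht]
    congr 2
    funext i
    congr 2
    ext
    change s.leaves + (i : ℕ) = (s.map f).leaves + (i : ℕ)
    exact congrArg (· + (i : ℕ)) (BTree.leaves_map f s).symm

theorem incl_freeMap (f : α → β) (n : ℕ) (x : Free R α n) :
    incl R n (freeMap R f n x) = totalMap R f (incl R n x) := by
  simp only [incl, freeMap, totalMap, Finsupp.lmapDomain_apply, ← Finsupp.mapDomain_comp]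
  rfl

theorem proj_single (t : BTree α) (n : ℕ) (c : R) :
    proj R n (Finsupp.single t c) =
      if h : t.leaves = n then Finsupp.single (⟨t, h⟩ : TreeN α n) c else 0 := by
  classical
  ext s
  change Finsupp.single t c s.1 = _
  split_ifs with h
  · simp [Finsupp.single_apply, Subtype.ext_iff]
  · have hs : t ≠ s.1 := by
      rintro rfl
      exact h s.2
    simp [hs]

theorem proj_totalMap (f : α → β) (n : ℕ) (x : Total R α) :
    proj R n (totalMap R f x) = freeMap R f n (proj R n x) := by
  have h : (proj R n) ∘ₗ (totalMap R f) = (freeMap R f n) ∘ₗ (proj R n) := by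
    ext t : 2
    by_cases ht : t.leaves = n <;>
      simp [totalMap, freeMap, proj_single, BTree.leaves_map, ht]
  exact LinearMap.congr_fun h x

theorem freeMap_comp (f : α → β) {l : ℕ} (m : Fin l → ℕ) (n : ℕ) (μ : Free R α l)
    (ν : ∀ i, Free R α (m i)) :
    freeMap R f n (comp R m n μ ν) =
      comp R m n (freeMap R f l μ) fun i => freeMap R f (m i) (ν i) := by
  induction μ using Finsupp.induction_linear with
  | zero => simp
  | add x y hx hy => simp only [map_add, add_apply, hx, hy]
  | single t c =>
    obtain ⟨t, rfl⟩ := t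
    simp only [comp, freeMap, Finsupp.lmapDomain_apply, Finsupp.mapDomain_single,
      Finsupp.linearCombination_single, smul_apply, map_smul]
    congr 1
    change freeMap R f n (proj R n (substFun R t fun i => incl R (m i) (ν i))) =
      proj R n (substFun R (t.map f) fun i =>
        incl R (m (finCongr (BTree.leaves_map f t) i))
          (freeMap R f _ (ν (finCongr (BTree.leaves_map f t) i))))
    rw [← proj_totalMap, totalMap_substFun]
    simp only [incl_freeMap]

end FreeOperad

/-! ### Operad ideals and operads given by generators and quadratic relations -/

section Quotient

variable {R : Type w} [CommRing R] {α : Type u} {β : Type v}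

/-- A collection of subspaces is an operad ideal if `μ(ν₁, …, ν_l)` lies in it whenever one of
`μ, ν₁, …, ν_l` does. -/
structure IsIdeal (I : ∀ n, Submodule R (Free R α n)) : Prop where
  outer : ∀ {l : ℕ} (m : Fin l → ℕ) (n : ℕ) (μ : Free R α l) (ν : ∀ i, Free R α (m i)),
    μ ∈ I l → comp R m n μ ν ∈ I n
  inner : ∀ {l : ℕ} (m : Fin l → ℕ) (n : ℕ) (μ : Free R α l) (ν : ∀ i, Free R α (m i)) (i : Fin l),
    ν i ∈ I (m i) → comp R m n μ ν ∈ I n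

/-- The operad ideal generated by quadratic relations `S ⊆ Free 3`. -/
def ideal (S : Submodule R (Free R α 3)) (n : ℕ) : Submodule R (Free R α n) :=
  ⨅ (I : ∀ n, Submodule R (Free R α n)) (_ : IsIdeal I) (_ : S ≤ I 3), I n

theorem mem_ideal {S : Submodule R (Free R α 3)} {n : ℕ} {x : Free R α n} :
    x ∈ ideal S n ↔ ∀ I : ∀ n, Submodule R (Free R α n), IsIdeal I → S ≤ I 3 → x ∈ I n := by
  simp [ideal, Submodule.mem_iInf]

theorem isIdeal_ideal (S : Submodule R (Free R α 3)) : IsIdeal (ideal S) where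
  outer m n μ ν h := mem_ideal.2 fun I hI hS => hI.outer m n μ ν (mem_ideal.1 h I hI hS)
  inner m n μ ν i h := mem_ideal.2 fun I hI hS => hI.inner m n μ ν i (mem_ideal.1 h I hI hS)

theorem le_ideal (S : Submodule R (Free R α 3)) : S ≤ ideal S 3 :=
  fun _ hx => mem_ideal.2 fun _ _ hS => hS hx

/-- The arity `n` component of the operad with generators `α` and relations `S`. -/
abbrev Operad (S : Submodule R (Free R α 3)) (n : ℕ) : Type (max u w) := Free R α n ⧸ ideal S n

/-- A multilinear map vanishing as soon as one argument is in the submodule `K i`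
depends only on the classes of its arguments. -/
theorem multilinear_congr {l : ℕ} {M : Fin l → Type*} [∀ i, AddCommGroup (M i)]
    [∀ i, Module R (M i)] {N : Type*} [AddCommGroup N] [Module R N] (K : ∀ i, Submodule R (M i))
    (g : MultilinearMap R M N) (hg : ∀ x i, x i ∈ K i → g x = 0) (x y : ∀ i, M i)
    (h : ∀ i, x i - y i ∈ K i) : g x = g y := by
  suffices H : ∀ s : Finset (Fin l), g (s.piecewise x y) = g y by
    simpa using H Finset.univ
  intro s
  induction s using Finset.induction_on with
  | empty => simp
  | insert i s hi ih =>
    rw [← ih, Finset.piecewise_insert, ← sub_eq_zero]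
    have h2 : s.piecewise x y = Function.update (s.piecewise x y) i (y i) := by
      simp [hi]
    conv_lhs => rw [h2, Function.update_idem, ← MultilinearMap.map_update_sub]
    refine hg _ i ?_
    simpa using h i

/-- Descent of a multilinear map to quotients. -/
def multilinearDescend {l : ℕ} {M : Fin l → Type*} [∀ i, AddCommGroup (M i)]
    [∀ i, Module R (M i)] {N : Type*} [AddCommGroup N] [Module R N] (K : ∀ i, Submodule R (M i))
    (g : MultilinearMap R M N) (hg : ∀ x i, x i ∈ K i → g x = 0) :
    MultilinearMap R (fun i => M i ⧸ K i) N where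
  toFun y := g fun i => (y i).out
  map_update_add' {inst} y i a b := by
    obtain rfl : inst = instDecidableEqFin _ := Subsingleton.elim _ _
    have key : ∀ c : M i ⧸ K i, ∀ c' : M i, Submodule.Quotient.mk c' = c →
        g (fun j => (Function.update y i c j).out) =
          g (Function.update (fun j => (y j).out) i c') := by
      rintro _ c' rfl
      refine multilinear_congr K g hg _ _ fun j => ?_
      rw [← Submodule.Quotient.eq]
      by_cases hj : j = i
      · subst hj; simp [Submodule.Quotient.mk_out]
      · simp [hj]
    rw [key (a + b) (a.out + b.out) (by simp [Submodule.Quotient.mk_out]),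
      key a a.out (Submodule.Quotient.mk_out _), key b b.out (Submodule.Quotient.mk_out _),
      g.map_update_add]
  map_update_smul' {inst} y i r a := by
    obtain rfl : inst = instDecidableEqFin _ := Subsingleton.elim _ _
    have key : ∀ c : M i ⧸ K i, ∀ c' : M i, Submodule.Quotient.mk c' = c →
        g (fun j => (Function.update y i c j).out) =
          g (Function.update (fun j => (y j).out) i c') := by
      rintro _ c' rfl
      refine multilinear_congr K g hg _ _ fun j => ?_
      rw [← Submodule.Quotient.eq]
      by_cases hj : j = i
      · subst hj; simp [Submodule.Quotient.mk_out]
      · simp [hj]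
    rw [key (r • a) (r • a.out) (by simp [Submodule.Quotient.mk_out]),
      key a a.out (Submodule.Quotient.mk_out _), g.map_update_smul]

theorem multilinearDescend_mk {l : ℕ} {M : Fin l → Type*} [∀ i, AddCommGroup (M i)]
    [∀ i, Module R (M i)] {N : Type*} [AddCommGroup N] [Module R N] (K : ∀ i, Submodule R (M i))
    (g : MultilinearMap R M N) (hg : ∀ x i, x i ∈ K i → g x = 0) (x : ∀ i, M i) :
    multilinearDescend K g hg (fun i => Submodule.Quotient.mk (x i)) = g x := by
  refine multilinear_congr K g hg _ _ fun j => ?_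
  rw [← Submodule.Quotient.eq]
  exact Submodule.Quotient.mk_out _

/-- The composition of the quotient operad, with the outer operation still in the free operad. -/
def compAux (S : Submodule R (Free R α 3)) {l : ℕ} (m : Fin l → ℕ) (n : ℕ) :
    Free R α l →ₗ[R] MultilinearMap R (fun i => Operad S (m i)) (Operad S n) where
  toFun μ := multilinearDescend (fun i => ideal S (m i))
    ((ideal S n).mkQ.compMultilinearMap (comp R m n μ)) fun ν i h => by
      simpa using (isIdeal_ideal S).inner m n μ ν i h
  map_add' μ μ' := by
    ext y
    simp [multilinearDescend]
  map_smul' c μ := by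
    ext y
    simp [multilinearDescend]

/-- The structure operation `(μ, (ν₁, …, ν_l)) ↦ μ(ν₁, …, ν_l)` of the operad with generators `α`
and relations `S`, for `n = m₁ + ⋯ + m_l`. -/
def compQ (S : Submodule R (Free R α 3)) {l : ℕ} (m : Fin l → ℕ) (n : ℕ) :
    Operad S l →ₗ[R] MultilinearMap R (fun i => Operad S (m i)) (Operad S n) :=
  (ideal S l).liftQ (compAux S m n) fun μ hμ => by
    rw [LinearMap.mem_ker]
    ext y
    simpa [compAux, multilinearDescend] using
      (isIdeal_ideal S).outer m n μ (fun i => (y i).out) hμ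

theorem compQ_mk (S : Submodule R (Free R α 3)) {l : ℕ} (m : Fin l → ℕ) (n : ℕ)
    (μ : Free R α l) (ν : ∀ i, Free R α (m i)) :
    compQ S m n (Submodule.Quotient.mk μ) (fun i => Submodule.Quotient.mk (ν i)) =
      Submodule.Quotient.mk (comp R m n μ ν) :=
  multilinearDescend_mk (fun i => ideal S (m i))
    ((ideal S n).mkQ.compMultilinearMap (comp R m n μ))
    (fun ν i h => by simpa using (isIdeal_ideal S).inner m n μ ν i h) ν

theorem ideal_le_comap (f : α → β) (S : Submodule R (Free R α 3)) (S' : Submodule R (Free R β 3))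
    (h : S.map (freeMap R f 3) ≤ S') (n : ℕ) :
    ideal S n ≤ (ideal S' n).comap (freeMap R f n) := by
  intro x hx
  refine mem_ideal.1 hx (fun n => (ideal S' n).comap (freeMap R f n)) ⟨?_, ?_⟩ ?_
  · intro l m n μ ν hμ
    rw [Submodule.mem_comap, freeMap_comp]
    exact (isIdeal_ideal S').outer _ _ _ _ hμ
  · intro l m n μ ν i hν
    rw [Submodule.mem_comap, freeMap_comp]
    exact (isIdeal_ideal S').inner _ _ _ _ i hν
  · exact (Submodule.map_le_iff_le_comap.1 h).trans (Submodule.comap_mono (le_ideal S'))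

/-- The morphism of operads induced by a map of generators that preserves relations. -/
def operadMap (f : α → β) (S : Submodule R (Free R α 3)) (S' : Submodule R (Free R β 3))
    (h : S.map (freeMap R f 3) ≤ S') (n : ℕ) : Operad S n →ₗ[R] Operad S' n :=
  (ideal S n).mapQ (ideal S' n) (freeMap R f n) (ideal_le_comap f S S' h n)

end Quotient

/-! ### Rewrite rules and distributive laws -/

section Distributive

variable (R : Type w) [CommRing R] {α : Type u} {β : Type v}

/-- The monomial `(x q y) p z`. -/
def leftTree (p q : α) : TreeN α 3 := ⟨.node p (.node q .leaf .leaf) .leaf, rfl⟩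

/-- The monomial `x p (y q z)`. -/
def rightTree (p q : α) : TreeN α 3 := ⟨.node p .leaf (.node q .leaf .leaf), rfl⟩

/-- `(x q y) p z` as an element of the free operad. -/
def leftMon (p q : α) : Free R α 3 := Finsupp.single (leftTree p q) 1

/-- `x p (y q z)` as an element of the free operad. -/
def rightMon (p q : α) : Free R α 3 := Finsupp.single (rightTree p q) 1

/-- The span of all `p(q, 1)` and `p(1, q)` with `p ∈ A` and `q ∈ B`. -/
def mixed (A B : Set α) : Submodule R (Free R α 3) :=
  Submodule.span R {x | ∃ p ∈ A, ∃ q ∈ B, x = leftMon R p q ∨ x = rightMon R p q}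

/-- The subspace `F(E₁ ⊕ E₂)(3)₁₂`, where `E₁` has basis `α` and `E₂` has basis `β`:
outer operation from `E₁`, inner operation from `E₂`. -/
abbrev F12 (α : Type u) (β : Type v) : Submodule R (Free R (α ⊕ β) 3) :=
  mixed R (Set.range Sum.inl) (Set.range Sum.inr)

/-- The subspace `F(E₁ ⊕ E₂)(3)₂₁`: outer operation from `E₂`, inner operation from `E₁`. -/
abbrev F21 (α : Type u) (β : Type v) : Submodule R (Free R (α ⊕ β) 3) :=
  mixed R (Set.range Sum.inr) (Set.range Sum.inl)

variable {R}

/-- The relations `x - D x`, `x ∈ F(E)(3)₁₂`. -/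
def ruleRel (D : F12 R α β →ₗ[R] F21 R α β) : Submodule R (Free R (α ⊕ β) 3) :=
  Submodule.span R (Set.range fun x : F12 R α β => (x : Free R (α ⊕ β) 3) - D x)

/-- The relations `R₁ ⊕ R_D ⊕ R₂` of the combined operad. -/
def combinedRel (R₁ : Submodule R (Free R α 3)) (R₂ : Submodule R (Free R β 3))
    (D : F12 R α β →ₗ[R] F21 R α β) : Submodule R (Free R (α ⊕ β) 3) :=
  R₁.map (freeMap R Sum.inl 3) ⊔ ruleRel D ⊔ R₂.map (freeMap R Sum.inr 3)

/-- The canonical morphism from `P₁ = ⟨E₁; R₁⟩` to the combined operad. -/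
def fromFirst (R₁ : Submodule R (Free R α 3)) (R₂ : Submodule R (Free R β 3))
    (D : F12 R α β →ₗ[R] F21 R α β) (n : ℕ) : Operad R₁ n →ₗ[R] Operad (combinedRel R₁ R₂ D) n :=
  operadMap Sum.inl R₁ _ (le_sup_left.trans le_sup_left) n

/-- The canonical morphism from `P₂ = ⟨E₂; R₂⟩` to the combined operad. -/
def fromSecond (R₁ : Submodule R (Free R α 3)) (R₂ : Submodule R (Free R β 3))
    (D : F12 R α β →ₗ[R] F21 R α β) (n : ℕ) : Operad R₂ n →ₗ[R] Operad (combinedRel R₁ R₂ D) n :=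
  operadMap Sum.inr R₂ _ le_sup_right n

open scoped TensorProduct DirectSum

/-- `(P₂ ∘ P₁)(n)`: the direct sum, over all `m₁ + ⋯ + m_l = n` with `m_s ≥ 1`, of
`P₂(l) ⊗ P₁(m₁) ⊗ ⋯ ⊗ P₁(m_l)`. -/
abbrev Composite (R₁ : Submodule R (Free R α 3)) (R₂ : Submodule R (Free R β 3)) (n : ℕ) :
    Type (max u v w) :=
  ⨁ c : Composition n,
    Operad R₂ c.length ⊗[R] (⨂[R] i : Fin c.length, Operad R₁ (c.blocksFun i))

/-- The map `ξ(n) : (P₂ ∘ P₁)(n) → P(n)` to the combined operad `P`, sending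
`μ ⊗ ν₁ ⊗ ⋯ ⊗ ν_l` to `μ(ν₁, …, ν_l)`. -/
def xi (R₁ : Submodule R (Free R α 3)) (R₂ : Submodule R (Free R β 3))
    (D : F12 R α β →ₗ[R] F21 R α β) (n : ℕ) :
    Composite R₁ R₂ n →ₗ[R] Operad (combinedRel R₁ R₂ D) n :=
  DirectSum.toModule R (Composition n) _ fun c =>
    TensorProduct.lift
      ((PiTensorProduct.lift (R := R)).toLinearMap ∘ₗ
        MultilinearMap.compLinearMapₗ (fun i => fromFirst R₁ R₂ D (c.blocksFun i)) ∘ₗ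
        compQ (combinedRel R₁ R₂ D) c.blocksFun n ∘ₗ
        fromSecond R₁ R₂ D c.length)

/-- `D` is a distributive law of `P₁ = ⟨E₁; R₁⟩` over `P₂ = ⟨E₂; R₂⟩`. -/
def IsDistributiveLaw (R₁ : Submodule R (Free R α 3)) (R₂ : Submodule R (Free R β 3))
    (D : F12 R α β →ₗ[R] F21 R α β) : Prop :=
  ∀ n : ℕ, 2 ≤ n → Function.Bijective (xi R₁ R₂ D n)

end Distributive

/-! ### Two associative multiplications -/

/-- The associativity relation `(xy)z - x(yz)` for one binary operation. -/
def assRel (R : Type w) [CommRing R] : Submodule R (Free R Unit 3) :=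
  Submodule.span R {leftMon R () () - rightMon R () ()}

/-- The two multiplications. -/
abbrev Op : Type := Unit ⊕ Unit

/-- The multiplication `•`, generating `E₁`. -/
abbrev bul : Op := Sum.inl ()

/-- The multiplication `∘`, generating `E₂`. -/
abbrev cir : Op := Sum.inr ()

/-- Rewrite rules, with left hand sides `(x ∘ y) • z` and `x • (y ∘ z)`. -/
abbrev Rule (R : Type w) [CommRing R] : Type w := F12 R Unit Unit →ₗ[R] F21 R Unit Unit

/-- `(x ∘ y) • z` -/
def lhs₁ (R : Type w) [CommRing R] : F12 R Unit Unit :=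
  ⟨leftMon R bul cir, Submodule.subset_span ⟨bul, ⟨(), rfl⟩, cir, ⟨(), rfl⟩, Or.inl rfl⟩⟩

/-- `x • (y ∘ z)` -/
def lhs₂ (R : Type w) [CommRing R] : F12 R Unit Unit :=
  ⟨rightMon R bul cir, Submodule.subset_span ⟨bul, ⟨(), rfl⟩, cir, ⟨(), rfl⟩, Or.inr rfl⟩⟩

/-- `(x • y) ∘ z` -/
def rhs₁ (R : Type w) [CommRing R] : F21 R Unit Unit :=
  ⟨leftMon R cir bul, Submodule.subset_span ⟨cir, ⟨(), rfl⟩, bul, ⟨(), rfl⟩, Or.inl rfl⟩⟩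

/-- `x ∘ (y • z)` -/
def rhs₂ (R : Type w) [CommRing R] : F21 R Unit Unit :=
  ⟨rightMon R cir bul, Submodule.subset_span ⟨cir, ⟨(), rfl⟩, bul, ⟨(), rfl⟩, Or.inr rfl⟩⟩

/-- `D` is a distributive law between two associative multiplications. -/
def IsAssAssLaw {R : Type w} [CommRing R] (D : Rule R) : Prop :=
  IsDistributiveLaw (assRel R) (assRel R) D

/-! ### The matrix of cubic consequences -/

section CubicMatrix

variable (A : Type w) [CommRing A]

/-- The four quadratic relations as functions of three arguments: associativity of `∘` and of `•`,
`(x ∘ y) • z + a (x • y) ∘ z + b x ∘ (y • z)` and `x • (y ∘ z) + c (x • y) ∘ z + d x ∘ (y • z)`. -/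
def quadRel (a b c d : A) : Fin 4 → Total A Op → Total A Op → Total A Op → Total A Op :=
  ![fun x y z => mul A cir (mul A cir x y) z - mul A cir x (mul A cir y z),
    fun x y z => mul A bul (mul A bul x y) z - mul A bul x (mul A bul y z),
    fun x y z => mul A bul (mul A cir x y) z + a • mul A cir (mul A bul x y) z
      + b • mul A cir x (mul A bul y z),
    fun x y z => mul A bul x (mul A cir y z) + c • mul A cir (mul A bul x y) z
      + d • mul A cir x (mul A bul y z)]

/-- The ten consequences of arity `4` of a quadratic relation `ρ`. All the variables `w, x, y, z`
are written as the one-leaf tree `e`, their order being the order of the leaves. -/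
def cubicConsequence (ρ : Total A Op → Total A Op → Total A Op → Total A Op) :
    Fin 10 → Total A Op :=
  let e : Total A Op := Finsupp.single BTree.leaf 1
  ![ρ (mul A cir e e) e e, ρ (mul A bul e e) e e, ρ e (mul A cir e e) e, ρ e (mul A bul e e) e,
    ρ e e (mul A cir e e), ρ e e (mul A bul e e), mul A cir (ρ e e e) e, mul A bul (ρ e e e) e,
    mul A cir e (ρ e e e), mul A bul e (ρ e e e)]

/-- The monomials of arity `4`: five association types with operations `p, q, r`. -/
def cubicMonomial (p q r : Op) : Fin 5 → BTree Op :=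
  let e : BTree Op := BTree.leaf
  ![.node r (.node q (.node p e e) e) e, .node r (.node p e (.node q e e)) e,
    .node q (.node p e e) (.node r e e), .node p e (.node r (.node q e e) e),
    .node p e (.node q e (.node r e e))]

end CubicMatrix

/-- The `40 × 40` matrix `[RR]` over `k[a, b, c, d]`: the rows are the ten cubic consequences of
each of the four quadratic relations, expanded in the monomials of arity `4`. -/
def cubicMatrix (k : Type w) [CommRing k] :
    Matrix (Fin 4 × Fin 10) (Fin 5 × Op × Op × Op) (MvPolynomial (Fin 4) k) :=
  fun i j =>
    cubicConsequence _
      (quadRel _ (MvPolynomial.X 0) (MvPolynomial.X 1) (MvPolynomial.X 2) (MvPolynomial.X 3) i.1)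
      i.2 (cubicMonomial j.2.1 j.2.2.1 j.2.2.2 j.1)

end NSOp

end

/-! The associative operad is one-dimensional in every positive arity, so the source of ξ(n) has a
basis indexed by the compositions of n and dimension 2^(n-1) (`finrank_composite`). The whole
argument compares this number with the dimension of the combined operad P(n).

The four rules have the form (x ∘ y) • z = e x ∘ (y • z), x • (y ∘ z) = e' (x • y) ∘ z with e, e' in
{0, 1}. Such rules push • below ∘, so the monomials in which no ∘ sits below a • span P(n), and ξ(n)
is surjective (`IsScalarRule.xi_surjective`). A lower bound comes from a model: on the span of the
words in the letters •, ∘, let an operation concatenate two words with its own letter in between,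
where • contributes a factor e if the left word contains ∘ and a factor e' if the right word does.
Because e and e' are idempotent, all relations hold (`IsScalarRule.combinedRel_le`), and suitable
normal monomials evaluate to the 2^(n-1) different words of length n-1. Hence dim P(n) = 2^(n-1),
and ξ(n) is bijective (`IsScalarRule.isAssAssLaw`).

Conversely, arity 4 decides. For arbitrary a, b, c, d the rows of [RR] express all 40 monomials
through 8 normal ones, so the rank is at least 32 (`le_rank`). If D is a law, then dim P(4) = 8 and
the rows come from an ideal component of dimension at most 40 - 8, so the rank is exactly 32
(`HasCoeffs.rank_eq`). If the rank is 32, the 8 normal monomials are independent modulo the rows;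
rewriting four overlaps in two ways then yields polynomial equations which, in characteristic 0,
force a = d = 0 and b, c in {0, -1} (`parameters_of_linearIndependent`). These are the four rules.
The cycle law ⇒ rank 32 ⇒ one of the four ⇒ law gives both equivalences. -/

noncomputable section

namespace NSOp

universe u v w

/-! ### Grading of the free operad by arity -/

section Homogeneous

variable {R : Type w} [CommRing R] {α : Type u}

theorem proj_incl (n : ℕ) (x : Free R α n) : proj R n (incl R n x) = x := by
  induction x using Finsupp.induction_linear with
  | zero => simp
  | add x y hx hy => simp [hx, hy]
  | single t c => simp [incl, proj_single, t.2]

theorem proj_incl_of_ne {m n : ℕ} (h : m ≠ n) (x : Free R α m) : proj R n (incl R m x) = 0 := by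
  induction x using Finsupp.induction_linear with
  | zero => simp
  | add x y hx hy => simp [hx, hy]
  | single t c => simp [incl, proj_single, t.2, h]

theorem mul_single_single (a : α) (s t : BTree α) (b c : R) :
    mul R a (Finsupp.single s b) (Finsupp.single t c) =
      Finsupp.single (BTree.node a s t) (b * c) := by
  simp [mul]

/-- The elements of degree `n` of the sum of all components. -/
def homog (R : Type w) [CommRing R] (α : Type u) (n : ℕ) : Submodule R (Total R α) :=
  LinearMap.range (incl R n)

theorem incl_mem_homog {n : ℕ} (x : Free R α n) : incl R n x ∈ homog R α n := ⟨x, rfl⟩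

theorem single_mem_homog (t : BTree α) (c : R) : Finsupp.single t c ∈ homog R α t.leaves :=
  ⟨Finsupp.single ⟨t, rfl⟩ c, by simp [incl]⟩

theorem incl_proj {n : ℕ} {x : Total R α} (hx : x ∈ homog R α n) : incl R n (proj R n x) = x := by
  obtain ⟨x, rfl⟩ := hx
  rw [proj_incl]

theorem proj_of_ne {m n : ℕ} (h : m ≠ n) {x : Total R α} (hx : x ∈ homog R α m) :
    proj R n x = 0 := by
  obtain ⟨x, rfl⟩ := hx
  exact proj_incl_of_ne h x

theorem mul_mem_homog (a : α) {p q : ℕ} {x y : Total R α} (hx : x ∈ homog R α p)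
    (hy : y ∈ homog R α q) : mul R a x y ∈ homog R α (p + q) := by
  obtain ⟨x, rfl⟩ := hx
  obtain ⟨y, rfl⟩ := hy
  induction x using Finsupp.induction_linear with
  | zero => simp
  | add x x' hx hx' => simpa using add_mem hx hx'
  | single s b =>
    induction y using Finsupp.induction_linear with
    | zero => simp
    | add y y' hy hy' => simpa using add_mem hy hy'
    | single t c =>
      obtain ⟨s, rfl⟩ := s
      obtain ⟨t, rfl⟩ := t
      simpa [incl, mul_single_single, -Finsupp.single_mul, BTree.leaves] using
        single_mem_homog (BTree.node a s t) (b * c)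

theorem substFun_mem_homog (t : BTree α) (m : Fin t.leaves → ℕ) (x : Fin t.leaves → Total R α)
    (hx : ∀ i, x i ∈ homog R α (m i)) : substFun R t x ∈ homog R α (∑ i, m i) := by
  induction t with
  | leaf =>
    have : ∑ i, m i = m (0 : Fin 1) := Fin.sum_univ_one (m : Fin 1 → ℕ)
    rw [this]
    exact hx (0 : Fin 1)
  | node a s t hs ht =>
    have : ∑ i, m i = ∑ i, m (Fin.castAdd t.leaves i) + ∑ i, m (Fin.natAdd s.leaves i) :=
      Fin.sum_univ_add (m : Fin (s.leaves + t.leaves) → ℕ)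
    rw [this]
    exact mul_mem_homog a (hs _ _ fun i => hx _) (ht _ _ fun i => hx _)

theorem comp_single {l : ℕ} (m : Fin l → ℕ) (n : ℕ) (t : TreeN α l) (c : R)
    (ν : ∀ i, Free R α (m i)) :
    comp R m n (Finsupp.single t c) ν =
      c • proj R n (substFun R t.1 fun i => incl R _ (ν (finCongr t.2 i))) := by
  simp only [comp, Finsupp.linearCombination_single]
  rfl

/-- The target arity n is a free parameter of `comp`, reached by projection; substitution is
homogeneous of degree ∑ m i, so nothing survives elsewhere. This disposes of the degenerate case in
each check of the ideal axioms. -/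
theorem comp_eq_zero {l : ℕ} (m : Fin l → ℕ) {n : ℕ} (h : ∑ i, m i ≠ n) (μ : Free R α l)
    (ν : ∀ i, Free R α (m i)) : comp R m n μ ν = 0 := by
  induction μ using Finsupp.induction_linear with
  | zero => simp
  | add x y hx hy => simp [hx, hy]
  | single t c =>
    obtain ⟨t, rfl⟩ := t
    rw [comp_single]
    exact (congrArg (c • ·) (proj_of_ne h
      (substFun_mem_homog t m _ fun i => incl_mem_homog (ν i)))).trans (smul_zero c)

theorem incl_comp_single {l : ℕ} (m : Fin l → ℕ) {n : ℕ} (h : ∑ i, m i = n) (t : TreeN α l) (c : R)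
    (ν : ∀ i, Free R α (m i)) :
    incl R n (comp R m n (Finsupp.single t c) ν) =
      c • substFun R t.1 fun i => incl R _ (ν (finCongr t.2 i)) := by
  obtain ⟨t, rfl⟩ := t
  subst h
  rw [comp_single, map_smul]
  congr 1
  exact incl_proj (substFun_mem_homog t m _ fun i => incl_mem_homog (ν i))

end Homogeneous

/-! ### Algebras over the free operad and their identities -/

section Evaluation

variable {R : Type w} [CommRing R] {α : Type u} {A : Type v} [AddCommGroup A] [Module R A]
  (B : α → A →ₗ[R] A →ₗ[R] A)

/-- The prefix sum is the position of the first variable of the i-th block after substitution. This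
lemma and the next split that offset between the left and right subtrees of a node. -/
theorem sum_lt_castAdd {p q : ℕ} (m : Fin (p + q) → ℕ) (i : Fin p) :
    (∑ r, if r < Fin.castAdd q i then m r else 0) =
      ∑ r, if r < i then m (Fin.castAdd q r) else 0 := by
  rw [Fin.sum_univ_add, Finset.sum_eq_zero (s := Finset.univ (α := Fin q)), add_zero]
  · rfl
  · refine fun r _ => if_neg ?_
    simp only [Fin.lt_def, Fin.val_natAdd, Fin.val_castAdd]
    omega

theorem sum_lt_natAdd {p q : ℕ} (m : Fin (p + q) → ℕ) (i : Fin q) :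
    (∑ r, if r < Fin.natAdd p i then m r else 0) =
      (∑ r, m (Fin.castAdd q r)) + ∑ r, if r < i then m (Fin.natAdd p r) else 0 := by
  rw [Fin.sum_univ_add]
  congr 1
  · refine Finset.sum_congr rfl fun r _ => if_pos ?_
    simp only [Fin.lt_def, Fin.val_natAdd, Fin.val_castAdd]
    omega
  · refine Finset.sum_congr rfl fun r _ => if_congr ?_ rfl rfl
    simp

/-- The value of a monomial at `y 0, y 1, …` in the algebra `A` with operations `B`. -/
def evalTree : BTree α → (ℕ → A) → A
  | .leaf, y => y 0
  | .node a s t, y => B a (evalTree s y) (evalTree t fun i => y (s.leaves + i))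

/-- Linear extension of the evaluation of monomials. -/
def evalTotal (y : ℕ → A) : Total R α →ₗ[R] A :=
  Finsupp.linearCombination R fun t => evalTree B t y

theorem evalTotal_single (y : ℕ → A) (t : BTree α) (c : R) :
    evalTotal B y (Finsupp.single t c) = c • evalTree B t y := by
  simp [evalTotal]

/-- Only the left factor has to be homogeneous: its arity is the shift of the variables read by the
right factor. -/
theorem evalTotal_mul (a : α) (y : ℕ → A) {p : ℕ} {x : Total R α} (hx : x ∈ homog R α p)
    (z : Total R α) :
    evalTotal B y (mul R a x z) =
      B a (evalTotal B y x) (evalTotal B (fun i => y (p + i)) z) := by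
  obtain ⟨x, rfl⟩ := hx
  induction x using Finsupp.induction_linear with
  | zero => simp
  | add x x' hx hx' => simp [hx, hx']
  | single s b =>
    induction z using Finsupp.induction_linear with
    | zero => simp
    | add z z' hz hz' => simp [hz, hz']
    | single t c =>
      obtain ⟨s, rfl⟩ := s
      simp [incl, mul_single_single, evalTotal, evalTree, mul_smul, smul_comm b c,
        -Finsupp.single_mul]

theorem evalTree_eq_zero (t : BTree α) (y : ℕ → A) (i : ℕ) (hi : i < t.leaves) (h : y i = 0) :
    evalTree B t y = 0 := by
  induction t generalizing y i with
  | leaf =>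
    obtain rfl : i = 0 := Nat.lt_one_iff.1 hi
    exact h
  | node a s t hs ht =>
    by_cases his : i < s.leaves
    · simp [evalTree, hs y i his h]
    · have hit : i - s.leaves < t.leaves := by
        simp only [BTree.leaves] at hi
        omega
      have := ht (fun j => y (s.leaves + j)) (i - s.leaves) hit (by
        simpa [Nat.add_sub_cancel' (not_lt.1 his)] using h)
      simp [evalTree, this]

/-- Evaluation turns substitution into composition of functions. The sequence z is constrained only
at the leaves of t, since its other entries are never read. -/
theorem evalTotal_substFun (t : BTree α) (m : Fin t.leaves → ℕ) (x : Fin t.leaves → Total R α)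
    (hx : ∀ i, x i ∈ homog R α (m i)) (y z : ℕ → A)
    (hz : ∀ i : Fin t.leaves, z i =
      evalTotal B (fun j => y ((∑ r, if r < i then m r else 0) + j)) (x i)) :
    evalTotal B y (substFun R t x) = evalTree B t z := by
  induction t generalizing y z with
  | leaf =>
    change evalTotal B y (x (0 : Fin 1)) = z 0
    refine Eq.trans ?_ (hz (0 : Fin 1)).symm
    change _ = evalTotal B (fun j => y ((∑ r : Fin 1, if r < 0 then m r else 0) + j)) _
    simp
  | node a s t hs ht =>
    simp only [substFun]
    rw [evalTotal_mul B a y (substFun_mem_homog s (fun i => m (Fin.castAdd t.leaves i)) _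
      fun i => hx _), evalTree]
    congr 1
    · congr 1
      refine hs _ _ (fun i => hx _) y z fun i => ?_
      refine (hz (Fin.castAdd t.leaves i)).trans ?_
      have : (∑ r : Fin (s.leaves + t.leaves), if r < Fin.castAdd t.leaves i then m r else 0) =
          ∑ r, if r < i then m (Fin.castAdd t.leaves r) else 0 :=
        sum_lt_castAdd m i
      exact congrArg (fun N => evalTotal B (fun j => y (N + j)) (x (Fin.castAdd t.leaves i))) this
    · refine ht (fun i => m (Fin.natAdd s.leaves i)) _ (fun i => hx _) _ _ fun i => ?_
      refine (hz (Fin.natAdd s.leaves i)).trans ?_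
      have : (∑ r : Fin (s.leaves + t.leaves), if r < Fin.natAdd s.leaves i then m r else 0) =
          (∑ r, m (Fin.castAdd t.leaves r)) +
            ∑ r, if r < i then m (Fin.natAdd s.leaves r) else 0 :=
        sum_lt_natAdd m i
      refine (congrArg (fun N => evalTotal B (fun j => y (N + j)) (x (Fin.natAdd s.leaves i)))
        this).trans ?_
      simp only [add_assoc]

theorem evalTotal_comp {l : ℕ} (m : Fin l → ℕ) {n : ℕ} (h : ∑ i, m i = n) (μ : Free R α l)
    (ν : ∀ i, Free R α (m i)) (y z : ℕ → A)
    (hz : ∀ i : Fin l, z i =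
      evalTotal B (fun j => y ((∑ r, if r < i then m r else 0) + j)) (incl R _ (ν i))) :
    evalTotal B y (incl R n (comp R m n μ ν)) = evalTotal B z (incl R l μ) := by
  induction μ using Finsupp.induction_linear with
  | zero => simp
  | add x x' hx hx' => simp [hx, hx']
  | single t c =>
    rw [incl_comp_single m h]
    obtain ⟨t, rfl⟩ := t
    rw [map_smul, show incl R t.leaves (Finsupp.single ⟨t, rfl⟩ c) = Finsupp.single t c by
      simp [incl], evalTotal_single]
    congr 1
    exact evalTotal_substFun B t m _ (fun i => incl_mem_homog (ν i)) y z hz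

/-- The operad ideal of all identities of the algebra `A`. -/
def identities (n : ℕ) : Submodule R (Free R α n) :=
  ⨅ y : ℕ → A, LinearMap.ker (evalTotal B y ∘ₗ incl R n)

theorem mem_identities {n : ℕ} {x : Free R α n} :
    x ∈ identities B n ↔ ∀ y, evalTotal B y (incl R n x) = 0 := by
  simp [identities]

theorem isIdeal_identities : IsIdeal (identities (R := R) B) := by
  constructor
  · intro l m n μ ν hμ
    by_cases h : ∑ i, m i = n
    · refine (mem_identities B).2 fun y => ?_
      -- Evaluation takes sequences indexed by ℕ, so the values of the inner operations are padded
      -- by an irrelevant 0 beyond l.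
      rw [evalTotal_comp B m h μ ν y (fun i => if hi : i < l then
        evalTotal B (fun j => y ((∑ r, if r < ⟨i, hi⟩ then m r else 0) + j))
          (incl R _ (ν ⟨i, hi⟩)) else 0) fun i => by simp]
      exact (mem_identities B).1 hμ _
    · rw [comp_eq_zero m h]
      exact zero_mem _
  · intro l m n μ ν i hν
    by_cases h : ∑ i, m i = n
    · refine (mem_identities B).2 fun y => ?_
      rw [evalTotal_comp B m h μ ν y (fun i => if hi : i < l then
        evalTotal B (fun j => y ((∑ r, if r < ⟨i, hi⟩ then m r else 0) + j))
          (incl R _ (ν ⟨i, hi⟩)) else 0) fun i => by simp]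
      -- Each monomial of μ is multilinear in its leaves, and the i-th leaf receives the value of ν
      -- i, which is 0.
      induction μ using Finsupp.induction_linear with
      | zero => simp
      | add x x' hx hx' => simp [hx, hx']
      | single t c =>
        obtain ⟨t, rfl⟩ := t
        rw [show incl R t.leaves (Finsupp.single ⟨t, rfl⟩ c) = Finsupp.single t c by
          simp [incl], evalTotal_single, evalTree_eq_zero B t _ i i.2, smul_zero]
        simpa using (mem_identities B).1 hν _
    · rw [comp_eq_zero m h]
      exact zero_mem _

/-- The ideal generated by S is the smallest one containing it. This is the source of all lower
bounds: a nonzero value in an algebra satisfying S shows that a class in the quotient operad is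
nonzero. -/
theorem ideal_le_identities {S : Submodule R (Free R α 3)} (h : S ≤ identities B 3) (n : ℕ) :
    ideal S n ≤ identities B n :=
  fun _ hx => mem_ideal.1 hx _ (isIdeal_identities B) h

end Evaluation

/-! ### Operad ideals as two-sided ideals for the generating operations -/

section TotalIdeal

variable {R : Type w} [CommRing R] {α : Type u} (S : Submodule R (Free R α 3))

/-- The sum of all components of the operad ideal generated by `S`. -/
def totalIdeal : Submodule R (Total R α) := ⨆ n, (ideal S n).map (incl R n)

variable {S}

theorem incl_mem_totalIdeal {n : ℕ} {x : Free R α n} (hx : x ∈ ideal S n) :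
    incl R n x ∈ totalIdeal S :=
  Submodule.mem_iSup_of_mem n (Submodule.mem_map_of_mem hx)

theorem proj_mem_ideal {x : Total R α} (hx : x ∈ totalIdeal S) (n : ℕ) : proj R n x ∈ ideal S n := by
  rw [totalIdeal] at hx
  induction hx using Submodule.iSup_induction' with
  | mem m x hx =>
    obtain ⟨x, hx, rfl⟩ := hx
    by_cases h : m = n
    · subst h
      rwa [proj_incl]
    · rw [proj_incl_of_ne h]
      exact zero_mem _
  | zero => simp
  | add x y _ _ hx hy => simpa using add_mem hx hy

/-- The product is the composition of the arity 2 generator a with x and y, so the ideal axiom for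
inner operations applies in either slot. -/
theorem mul_mem_totalIdeal_aux (a : α) {p q : ℕ} (x : Free R α p) (y : Free R α q)
    (h : x ∈ ideal S p ∨ y ∈ ideal S q) :
    mul R a (incl R p x) (incl R q y) ∈ totalIdeal S := by
  let m : Fin 2 → ℕ := ![p, q]
  let ν : ∀ i, Free R α (m i) := Fin.cons x (Fin.cons y finZeroElim)
  have key : incl R (p + q) (comp R m (p + q)
      (Finsupp.single ⟨.node a .leaf .leaf, rfl⟩ 1) ν) = mul R a (incl R p x) (incl R q y) := by
    rw [incl_comp_single m (by simp [m]), one_smul]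
    rfl
  rw [← key]
  refine incl_mem_totalIdeal ?_
  rcases h with h | h
  · exact (isIdeal_ideal S).inner m _ _ ν 0 h
  · exact (isIdeal_ideal S).inner m _ _ ν 1 h

theorem mul_mem_totalIdeal_left (a : α) {x : Total R α} (hx : x ∈ totalIdeal S) (y : Total R α) :
    mul R a x y ∈ totalIdeal S := by
  rw [totalIdeal] at hx
  induction hx using Submodule.iSup_induction' with
  | mem m x hx =>
    obtain ⟨x, hx, rfl⟩ := hx
    induction y using Finsupp.induction_linear with
    | zero => simp
    | add y y' hy hy' => simpa using add_mem hy hy'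
    | single t c =>
      simpa [incl] using mul_mem_totalIdeal_aux a x (Finsupp.single (⟨t, rfl⟩ : TreeN α _) c)
        (Or.inl hx)
  | zero => simp
  | add x x' _ _ hx hx' => simpa using add_mem hx hx'

theorem mul_mem_totalIdeal_right (a : α) (x : Total R α) {y : Total R α} (hy : y ∈ totalIdeal S) :
    mul R a x y ∈ totalIdeal S := by
  rw [totalIdeal] at hy
  induction hy using Submodule.iSup_induction' with
  | mem m y hy =>
    obtain ⟨y, hy, rfl⟩ := hy
    induction x using Finsupp.induction_linear with
    | zero => simp
    | add x x' hx hx' => simpa using add_mem hx hx'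
    | single t c =>
      simpa [incl] using mul_mem_totalIdeal_aux a (Finsupp.single (⟨t, rfl⟩ : TreeN α _) c) y
        (Or.inr hy)
  | zero => simp
  | add x x' _ _ hx hx' => simpa using add_mem hx hx'

/-- Substitution into an element of the free operad, as a multilinear map. -/
def substFree (l : ℕ) : Free R α l →ₗ[R] MultilinearMap R (fun _ : Fin l => Total R α) (Total R α) :=
  Finsupp.linearCombination R fun t : TreeN α l => (subst R t.1).domDomCongr (finCongr t.2)

theorem incl_comp {l : ℕ} (m : Fin l → ℕ) {n : ℕ} (h : ∑ i, m i = n) (μ : Free R α l)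
    (ν : ∀ i, Free R α (m i)) :
    incl R n (comp R m n μ ν) = substFree l μ fun i => incl R _ (ν i) := by
  induction μ using Finsupp.induction_linear with
  | zero => simp
  | add x x' hx hx' => simp [hx, hx']
  | single t c =>
    rw [incl_comp_single m h, substFree, Finsupp.linearCombination_single]
    rfl

/-- On basis trees the substitution is an operadic composition with outer operation in the ideal;
multilinearity extends this to inhomogeneous arguments. Thus relations may be applied to arbitrary
elements of the sum of all components. -/
theorem substFree_mem_totalIdeal {l : ℕ} {μ : Free R α l} (hμ : μ ∈ ideal S l)
    (x : Fin l → Total R α) : substFree l μ x ∈ totalIdeal S := by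
  have : (totalIdeal S).mkQ.compMultilinearMap (substFree l μ) = 0 := by
    refine Module.Basis.ext_multilinear (fun _ => Finsupp.basisSingleOne) fun v => ?_
    have h := incl_comp (fun i => (v i).leaves) rfl μ
      fun i => Finsupp.single (⟨v i, rfl⟩ : TreeN α _) 1
    have h' := incl_mem_totalIdeal ((isIdeal_ideal S).outer (fun i => (v i).leaves)
      (∑ i, (v i).leaves) μ (fun i => Finsupp.single (⟨v i, rfl⟩ : TreeN α _) 1) hμ)
    rw [h] at h'
    simpa [incl] using h'
  have := congrArg (fun g => g x) this
  simpa using this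

theorem substFree_leftMon (p q : α) (x y z : Total R α) :
    substFree 3 (leftMon R p q) ![x, y, z] = mul R p (mul R q x y) z := by
  rw [substFree, leftMon, Finsupp.linearCombination_single, one_smul]
  rfl

theorem substFree_rightMon (p q : α) (x y z : Total R α) :
    substFree 3 (rightMon R p q) ![x, y, z] = mul R p x (mul R q y z) := by
  rw [substFree, rightMon, Finsupp.linearCombination_single, one_smul]
  rfl

end TotalIdeal

open scoped TensorProduct DirectSum

/-! ### The associative operad and the dimension of the composite -/

section Associative

theorem mul_assoc_mem_totalIdeal (R : Type w) [CommRing R] (x y z : Total R Unit) :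
    mul R () (mul R () x y) z - mul R () x (mul R () y z) ∈ totalIdeal (assRel R) := by
  have := substFree_mem_totalIdeal (le_ideal _ (Submodule.mem_span_singleton_self
    (leftMon R () () - rightMon R () ()))) ![x, y, z]
  rwa [map_sub, sub_apply, substFree_leftMon, substFree_rightMon] at this

/-- The right comb with `n + 1` leaves. -/
def rightComb : ℕ → BTree Unit
  | 0 => .leaf
  | n + 1 => .node () .leaf (rightComb n)

theorem leaves_rightComb (n : ℕ) : (rightComb n).leaves = n + 1 := by
  induction n with
  | zero => rfl
  | succ n ih => simp [rightComb, BTree.leaves, ih, add_comm]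

theorem BTree.leaves_pos {α : Type u} (t : BTree α) : 0 < t.leaves := by
  induction t with
  | leaf => exact Nat.one_pos
  | node a s t hs ht => exact Nat.add_pos_left hs _

variable (R : Type w) [CommRing R]

/-- Induction on p: one associativity step moves the first leaf to the root, and the induction
hypothesis applies under it. The index of a comb is its number of leaves minus one, which explains p
+ q + 1. -/
theorem node_rightComb_sub_mem (p q : ℕ) :
    Finsupp.single (.node () (rightComb p) (rightComb q)) 1 -
      Finsupp.single (rightComb (p + q + 1)) 1 ∈ totalIdeal (assRel R) := by
  induction p with
  | zero => simp [rightComb]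
  | succ p ih =>
    have h := mul_assoc_mem_totalIdeal R (Finsupp.single .leaf 1)
      (Finsupp.single (rightComb p) 1) (Finsupp.single (rightComb q) 1)
    have h' := mul_mem_totalIdeal_right () (Finsupp.single .leaf 1) ih
    have e : p + 1 + q + 1 = (p + q + 1) + 1 := by omega
    rw [e]
    simp only [map_sub, mul_single_single, mul_one, rightComb] at h h' ⊢
    simpa using add_mem h h'

/-- Straighten both subtrees into combs, then merge the two combs. Hence every component of the
associative operad is spanned by a single class. -/
theorem single_sub_rightComb_mem (t : BTree Unit) :
    Finsupp.single t 1 - Finsupp.single (rightComb (t.leaves - 1)) 1 ∈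
      totalIdeal (assRel R) := by
  induction t with
  | leaf => simp [rightComb, BTree.leaves]
  | node a s t hs ht =>
    have h := mul_mem_totalIdeal_left () hs (Finsupp.single t 1)
    have h' := mul_mem_totalIdeal_right () (Finsupp.single (rightComb (s.leaves - 1)) 1) ht
    have h'' := node_rightComb_sub_mem R (s.leaves - 1) (t.leaves - 1)
    have e : s.leaves - 1 + (t.leaves - 1) + 1 = (BTree.node a s t).leaves - 1 := by
      have := s.leaves_pos
      have := t.leaves_pos
      simp only [BTree.leaves]
      omega
    rw [e] at h''
    simp only [map_sub, LinearMap.sub_apply, mul_single_single, mul_one] at h h' h''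
    simpa using add_mem (add_mem h h') h''

theorem mk_eq_of_sub_mem {R : Type w} [CommRing R] {α : Type u} {S : Submodule R (Free R α 3)}
    {n : ℕ} {x y : Free R α n} (h : incl R n x - incl R n y ∈ totalIdeal S) :
    (Submodule.Quotient.mk x : Operad S n) = Submodule.Quotient.mk y := by
  rw [Submodule.Quotient.eq]
  simpa [proj_incl] using proj_mem_ideal h n

/-- The class of the right comb in the associative operad. -/
def assGen (n : ℕ) (hn : 1 ≤ n) : Operad (assRel R) n :=
  Submodule.Quotient.mk (Finsupp.single ⟨rightComb (n - 1), by rw [leaves_rightComb]; omega⟩ 1)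

theorem mk_single_eq_assGen (n : ℕ) (hn : 1 ≤ n) (t : TreeN Unit n) :
    (Submodule.Quotient.mk (Finsupp.single t 1) : Operad (assRel R) n) = assGen R n hn := by
  refine mk_eq_of_sub_mem ?_
  have := single_sub_rightComb_mem R t.1
  rw [t.2] at this
  simpa [incl] using this

theorem evalTree_lsmul_one (t : BTree Unit) :
    evalTree (fun _ : Unit => LinearMap.lsmul R R) t (fun _ => 1) = 1 := by
  induction t with
  | leaf => rfl
  | node a s t hs ht => simp [evalTree, hs, ht]

theorem assRel_le_identities :
    assRel R ≤ identities (fun _ : Unit => LinearMap.lsmul R R) 3 := by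
  rw [assRel, Submodule.span_singleton_le_iff_mem, mem_identities]
  intro y
  rw [map_sub, map_sub]
  simp [leftMon, rightMon, incl, evalTotal_single, leftTree, rightTree, evalTree, BTree.leaves,
    mul_assoc]

/-- The ring R with its own multiplication is an associative algebra in which every monomial takes
the value 1 at (1, 1, …). -/
theorem assGen_ne_zero [Nontrivial R] (n : ℕ) (hn : 1 ≤ n) : assGen R n hn ≠ 0 := by
  rw [assGen, Ne, Submodule.Quotient.mk_eq_zero]
  intro h
  have := (mem_identities _).1 (ideal_le_identities _ (assRel_le_identities R) n h) fun _ => 1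
  simp [incl, evalTotal_single, evalTree_lsmul_one] at this

theorem exists_smul_assGen (n : ℕ) (hn : 1 ≤ n) (x : Operad (assRel R) n) :
    ∃ c : R, c • assGen R n hn = x := by
  obtain ⟨x, rfl⟩ := Submodule.Quotient.mk_surjective _ x
  induction x using Finsupp.induction_linear with
  | zero => exact ⟨0, by simp⟩
  | add x y hx hy =>
    obtain ⟨c, hc⟩ := hx
    obtain ⟨d, hd⟩ := hy
    exact ⟨c + d, by rw [add_smul, hc, hd, Submodule.Quotient.mk_add]⟩
  | single t c =>
    exact ⟨c, by rw [← mk_single_eq_assGen R n hn t, ← Submodule.Quotient.mk_smul]; simp⟩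

/-- Each component of the associative operad in positive arity is one-dimensional. -/
def assEquiv (k : Type w) [Field k] (n : ℕ) (hn : 1 ≤ n) : Operad (assRel k) n ≃ₗ[k] k :=
  (LinearEquiv.ofBijective (LinearMap.toSpanSingleton k _ (assGen k n hn))
    ⟨smul_left_injective k (assGen_ne_zero k n hn), exists_smul_assGen k n hn⟩).symm

/-- The composite of two associative operads has a basis indexed by compositions. -/
def compositeEquiv (k : Type w) [Field k] (n : ℕ) (hn : 1 ≤ n) :
    Composite (assRel k) (assRel k) n ≃ₗ[k] (Composition n → k) :=
  (DFinsupp.mapRange.linearEquiv fun c : Composition n =>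
    (TensorProduct.congr (assEquiv k c.length (c.length_pos_of_pos hn))
      ((PiTensorProduct.congr fun i => assEquiv k (c.blocksFun i) (c.one_le_blocksFun i)).trans
        (PiTensorProduct.constantBaseRingEquiv (Fin c.length) k).toLinearEquiv)).trans
      (TensorProduct.lid k k)).trans
    (DirectSum.linearEquivFunOnFintype k (Composition n) fun _ => k)

theorem finrank_composite (k : Type w) [Field k] (n : ℕ) (hn : 1 ≤ n) :
    Module.finrank k (Composite (assRel k) (assRel k) n) = 2 ^ (n - 1) := by
  rw [(compositeEquiv k n hn).finrank_eq, Module.finrank_pi, composition_card]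

theorem finite_composite (k : Type w) [Field k] (n : ℕ) (hn : 1 ≤ n) :
    Module.Finite k (Composite (assRel k) (assRel k) n) :=
  Module.Finite.equiv (compositeEquiv k n hn).symm

end Associative

/-! ### Normal monomials and surjectivity of ξ -/

section Surjectivity

theorem exists_composition {n l : ℕ} (m : Fin l → ℕ) (hm : ∀ i, 1 ≤ m i) (hs : ∑ i, m i = n) :
    ∃ c : Composition n, ∃ h : l = c.length, ∀ i, m i = c.blocksFun (Fin.cast h i) :=
  ⟨⟨List.ofFn m, by
    simpa [List.forall_mem_ofFn_iff] using fun i => Nat.succ_le_iff.1 (hm i), by rw [List.sum_ofFn, hs]⟩,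
    by simp [Composition.length], fun i => by simp [Composition.blocksFun]⟩

/-- Frees the description of the range from `Composition`: any family of positive arities with the
right sum is the block family of a composition. -/
theorem compQ_mem_range_xi {R : Type w} [CommRing R] {α : Type u} {β : Type v}
    (R₁ : Submodule R (Free R α 3)) (R₂ : Submodule R (Free R β 3))
    (D : F12 R α β →ₗ[R] F21 R α β) {n l : ℕ} (m : Fin l → ℕ) (hm : ∀ i, 1 ≤ m i)
    (hs : ∑ i, m i = n) (μ : Operad R₂ l) (ν : ∀ i, Operad R₁ (m i)) :
    compQ (combinedRel R₁ R₂ D) m n (fromSecond R₁ R₂ D l μ)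
      (fun i => fromFirst R₁ R₂ D (m i) (ν i)) ∈ LinearMap.range (xi R₁ R₂ D n) := by
  obtain ⟨c, rfl, h⟩ := exists_composition m hm hs
  obtain rfl : m = c.blocksFun := funext h
  exact ⟨DirectSum.lof R (Composition n) _ c (μ ⊗ₜ PiTensorProduct.tprod R ν), by
    simp [xi, DirectSum.toModule_lof]⟩

/-- Monomials without an operation `∘` below an operation `•`. -/
inductive IsNormal : BTree Op → Prop
  | bul (t : BTree Unit) : IsNormal (t.map Sum.inl)
  | cir {s t : BTree Op} : IsNormal s → IsNormal t → IsNormal (.node cir s t)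

variable (k : Type w) [CommRing k]

/-- Cutting a normal monomial where ∘ stops leaves a tree u of operations ∘ with pure • trees x at
its leaves, which is the shape of the elements ξ produces. -/
theorem IsNormal.exists_subst {t : BTree Op} (ht : IsNormal t) :
    ∃ (u : BTree Unit) (x : Fin u.leaves → BTree Unit), ∑ i, (x i).leaves = t.leaves ∧
      Finsupp.single t (1 : k) = substFun k (u.map Sum.inr)
        fun i => Finsupp.single
          ((x (finCongr (BTree.leaves_map Sum.inr u) i)).map Sum.inl : BTree Op) 1 := by
  induction ht with
  | bul t => exact ⟨.leaf, fun _ => t,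
      (Fin.sum_univ_one _).trans (BTree.leaves_map _ t).symm, rfl⟩
  | cir hs ht ihs iht =>
    obtain ⟨u, x, hs, hx⟩ := ihs
    obtain ⟨v, y, ht, hy⟩ := iht
    refine ⟨.node () u v, Fin.append x y, ?_, ?_⟩
    · refine (Fin.sum_univ_add (fun i => (Fin.append x y i).leaves)).trans ?_
      simp [BTree.leaves, hs, ht]
    have := congrArg₂ (fun a b => mul k NSOp.cir a b) hx hy
    simp only [mul_single_single, mul_one] at this
    rw [this]
    change _ = mul k NSOp.cir (substFun k (u.map Sum.inr) _) (substFun k (v.map Sum.inr) _)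
    refine congrArg₂ (fun a b => mul k NSOp.cir a b) (congrArg _ ?_) (congrArg _ ?_)
    · funext i
      have : Fin.append x y (finCongr (BTree.leaves_map Sum.inr (.node () u v))
          (Fin.castAdd (v.map (Sum.inr : Unit → Op)).leaves i)) =
          x (finCongr (BTree.leaves_map Sum.inr u) i) :=
        Fin.append_left x y (finCongr (BTree.leaves_map Sum.inr u) i)
      exact congrArg (fun z : BTree Unit => Finsupp.single (z.map Sum.inl : BTree Op) (1 : k))
        this.symm
    · funext i
      have : Fin.append x y (finCongr (BTree.leaves_map Sum.inr (.node () u v))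
          (Fin.natAdd (u.map (Sum.inr : Unit → Op)).leaves i)) =
          y (finCongr (BTree.leaves_map Sum.inr v) i) := by
        refine (congrArg (Fin.append x y) ?_).trans
          (Fin.append_right x y (finCongr (BTree.leaves_map Sum.inr v) i))
        ext
        exact congrArg (· + (i : ℕ)) (BTree.leaves_map Sum.inr u)
      exact congrArg (fun z : BTree Unit => Finsupp.single (z.map Sum.inl : BTree Op) (1 : k))
        this.symm

variable {k}

theorem mk_mem_range_xi (R₁ R₂ : Submodule k (Free k Unit 3)) (D : Rule k) {t : BTree Op}
    (ht : IsNormal t) {n : ℕ} (h : t.leaves = n) :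
    (Submodule.Quotient.mk (Finsupp.single ⟨t, h⟩ 1) : Operad (combinedRel R₁ R₂ D) n) ∈
      LinearMap.range (xi R₁ R₂ D n) := by
  obtain ⟨u, x, hs, hx⟩ := ht.exists_subst k
  have := compQ_mem_range_xi R₁ R₂ D (fun i => (x i).leaves) (fun i => (x i).leaves_pos) (hs.trans h)
    (Submodule.Quotient.mk (Finsupp.single ⟨u, rfl⟩ 1))
    (fun i => Submodule.Quotient.mk (Finsupp.single ⟨x i, rfl⟩ 1))
  convert this using 1
  simp only [fromFirst, fromSecond, operadMap]
  erw [compQ_mk]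
  congr 1
  simp only [freeMap, Finsupp.lmapDomain_apply, Finsupp.mapDomain_single]
  rw [comp_single, one_smul]
  have := congrArg (proj k n) hx
  rw [proj_single, dif_pos h] at this
  rw [this]
  simp [incl]

/-- Congruence of `x` to a linear combination of normal monomials. -/
def normalSpan (S : Submodule k (Free k Op 3)) : Submodule k (Total k Op) :=
  totalIdeal S ⊔ Submodule.span k {x | ∃ t, IsNormal t ∧ x = Finsupp.single t 1}

theorem mem_normalSpan_of_mem {S : Submodule k (Free k Op 3)} {x : Total k Op}
    (hx : x ∈ totalIdeal S) : x ∈ normalSpan S :=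
  Submodule.mem_sup_left hx

theorem single_mem_normalSpan (S : Submodule k (Free k Op 3)) {t : BTree Op} (ht : IsNormal t) :
    Finsupp.single t 1 ∈ normalSpan S :=
  Submodule.mem_sup_right (Submodule.subset_span ⟨t, ht, rfl⟩)

/-- The ideal part absorbs products and the rest is bilinear, so only products of two normal
monomials have to be reduced. -/
theorem mul_mem_normalSpan {S : Submodule k (Free k Op 3)} {a : Op} {x y : Total k Op}
    (hx : x ∈ normalSpan S) (hy : y ∈ normalSpan S)
    (h : ∀ s t, IsNormal s → IsNormal t → Finsupp.single (.node a s t) 1 ∈ normalSpan S) :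
    mul k a x y ∈ normalSpan S := by
  obtain ⟨x₀, hx₀, x, hx', rfl⟩ := Submodule.mem_sup.1 hx
  obtain ⟨y₀, hy₀, y, hy', rfl⟩ := Submodule.mem_sup.1 hy
  rw [LinearMap.map_add₂, map_add (mul k a x)]
  refine add_mem (Submodule.mem_sup_left (mul_mem_totalIdeal_left a hx₀ _))
    (add_mem (Submodule.mem_sup_left (mul_mem_totalIdeal_right a x hy₀)) ?_)
  clear hx hy
  induction hx' using Submodule.span_induction with
  | zero => simp
  | add x x' _ _ hx hx' => simpa using add_mem hx hx'
  | smul c x _ hx => simpa using Submodule.smul_mem _ c hx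
  | mem x hx =>
    obtain ⟨s, hs, rfl⟩ := hx
    induction hy' using Submodule.span_induction with
    | zero => simp
    | add y y' _ _ hy hy' => simpa using add_mem hy hy'
    | smul c y _ hy => simpa using Submodule.smul_mem _ c hy
    | mem y hy =>
      obtain ⟨t, ht, rfl⟩ := hy
      rw [mul_single_single, mul_one]
      exact h s t hs ht

theorem cir_mem_normalSpan {S : Submodule k (Free k Op 3)} {x y : Total k Op}
    (hx : x ∈ normalSpan S) (hy : y ∈ normalSpan S) : mul k cir x y ∈ normalSpan S :=
  mul_mem_normalSpan hx hy fun _ _ hs ht => single_mem_normalSpan S (.cir hs ht)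

/-- The rewrite rule with `(x ∘ y) • z = e (x ∘ (y • z))` and `x • (y ∘ z) = e' ((x • y) ∘ z)`. -/
def IsScalarRule (D : Rule k) (e e' : k) : Prop :=
  D (lhs₁ k) = e • rhs₂ k ∧ D (lhs₂ k) = e' • rhs₁ k

theorem sub_mem_combinedRel (R₁ R₂ : Submodule k (Free k Unit 3)) (D : Rule k)
    (x : F12 k Unit Unit) : (x : Free k Op 3) - D x ∈ combinedRel R₁ R₂ D :=
  Submodule.mem_sup_left (Submodule.mem_sup_right (Submodule.subset_span ⟨x, rfl⟩))

variable {R₁ R₂ : Submodule k (Free k Unit 3)} {D : Rule k} {e e' : k}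

theorem IsScalarRule.left_mem (h : IsScalarRule D e e') (x y z : Total k Op) :
    mul k bul (mul k cir x y) z - e • mul k cir x (mul k bul y z) ∈
      totalIdeal (combinedRel R₁ R₂ D) := by
  have := substFree_mem_totalIdeal (le_ideal _ (sub_mem_combinedRel R₁ R₂ D (lhs₁ k))) ![x, y, z]
  rw [h.1, map_sub, sub_apply, Submodule.coe_smul, map_smul, smul_apply] at this
  simpa only [lhs₁, rhs₂, substFree_leftMon, substFree_rightMon] using this

theorem IsScalarRule.right_mem (h : IsScalarRule D e e') (x y z : Total k Op) :
    mul k bul x (mul k cir y z) - e' • mul k cir (mul k bul x y) z ∈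
      totalIdeal (combinedRel R₁ R₂ D) := by
  have := substFree_mem_totalIdeal (le_ideal _ (sub_mem_combinedRel R₁ R₂ D (lhs₂ k))) ![x, y, z]
  rw [h.2, map_sub, sub_apply, Submodule.coe_smul, map_smul, smul_apply] at this
  simpa only [lhs₂, rhs₁, substFree_leftMon, substFree_rightMon] using this

/-- If a factor has root ∘, the rule moves ∘ to the root and leaves a • product with fewer leaves,
so induction on the number of leaves terminates. Only spanning is claimed, so the choice to treat
the left factor first is harmless and no confluence is needed. -/
theorem IsScalarRule.bul_mem_normalSpan (h : IsScalarRule D e e') (n : ℕ) (s t : BTree Op)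
    (hs : IsNormal s) (ht : IsNormal t) (hn : s.leaves + t.leaves ≤ n) :
    Finsupp.single (.node bul s t) 1 ∈ normalSpan (combinedRel R₁ R₂ D) := by
  induction n generalizing s t with
  | zero =>
    have := s.leaves_pos
    omega
  | succ n ih =>
    cases hs with
    | @cir s₁ s₂ hs₁ hs₂ =>
      have hl := s₁.leaves_pos
      simp only [BTree.leaves] at hn
      have h1 := h.left_mem (R₁ := R₁) (R₂ := R₂) (Finsupp.single s₁ 1) (Finsupp.single s₂ 1)
        (Finsupp.single t 1)
      have h2 := cir_mem_normalSpan (single_mem_normalSpan (combinedRel R₁ R₂ D) hs₁)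
        (ih s₂ t hs₂ ht (by omega))
      simp only [mul_single_single, mul_one] at h1 h2
      simpa [-Finsupp.smul_single] using add_mem (S := Submodule k (Total k Op))
        (mem_normalSpan_of_mem h1) (Submodule.smul_mem _ e h2)
    | bul s =>
      cases ht with
      | @cir t₁ t₂ ht₁ ht₂ =>
        have hl := t₂.leaves_pos
        simp only [BTree.leaves] at hn
        have h1 := h.right_mem (R₁ := R₁) (R₂ := R₂) (Finsupp.single (s.map Sum.inl) 1)
          (Finsupp.single t₁ 1) (Finsupp.single t₂ 1)
        have h2 := cir_mem_normalSpan (ih (s.map Sum.inl) t₁ (.bul s) ht₁ (by omega))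
          (single_mem_normalSpan (combinedRel R₁ R₂ D) ht₂)
        simp only [mul_single_single, mul_one] at h1 h2
        simpa [-Finsupp.smul_single] using add_mem (S := Submodule k (Total k Op))
          (mem_normalSpan_of_mem h1) (Submodule.smul_mem _ e' h2)
      | bul t => exact single_mem_normalSpan _ (.bul (.node () s t))

theorem IsScalarRule.normalSpan_eq_top (h : IsScalarRule D e e') :
    normalSpan (combinedRel R₁ R₂ D) = ⊤ := by
  rw [eq_top_iff]
  rintro x -
  induction x using Finsupp.induction_linear with
  | zero => exact zero_mem _
  | add x y hx hy => exact add_mem hx hy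
  | single t c =>
    rw [← mul_one c, ← smul_eq_mul, ← Finsupp.smul_single]
    refine Submodule.smul_mem _ c ?_
    induction t with
    | leaf => exact single_mem_normalSpan _ (.bul .leaf)
    | node a s t hs ht =>
      rw [← mul_one (1 : k), ← mul_single_single]
      match a with
      | .inl () => exact mul_mem_normalSpan hs ht fun s t hs ht =>
          h.bul_mem_normalSpan _ s t hs ht le_rfl
      | .inr () => exact cir_mem_normalSpan hs ht

theorem IsScalarRule.xi_surjective (h : IsScalarRule D e e') (n : ℕ) :
    Function.Surjective (xi R₁ R₂ D n) := by
  intro z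
  obtain ⟨x, rfl⟩ := Submodule.Quotient.mk_surjective _ z
  have hx : incl k n x ∈ normalSpan (combinedRel R₁ R₂ D) := by
    rw [h.normalSpan_eq_top]
    trivial
  obtain ⟨y, hy, z, hz, hyz⟩ := Submodule.mem_sup.1 hx
  have e1 : (Submodule.Quotient.mk x : Operad (combinedRel R₁ R₂ D) n) =
      Submodule.Quotient.mk (proj k n z) := by
    rw [Submodule.Quotient.eq, ← proj_incl n x, ← map_sub, ← hyz, add_sub_cancel_right]
    exact proj_mem_ideal hy n
  have key : Submodule.span k {x | ∃ t, IsNormal t ∧ x = Finsupp.single t 1} ≤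
      (LinearMap.range (xi R₁ R₂ D n)).comap
        ((ideal (combinedRel R₁ R₂ D) n).mkQ ∘ₗ proj k n) := by
    rw [Submodule.span_le]
    rintro _ ⟨t, ht, rfl⟩
    change Submodule.Quotient.mk (proj k n _) ∈ LinearMap.range (xi R₁ R₂ D n)
    rw [proj_single]
    split_ifs with h
    · exact mk_mem_range_xi R₁ R₂ D ht h
    · exact zero_mem _
  rw [e1]
  exact key hz

end Surjectivity

/-! ### The algebra of words in • and ∘ -/

section Model

variable {k : Type w} [CommRing k]

theorem F12_hom_ext {M : Type*} [AddCommMonoid M] [Module k M] {f g : F12 k Unit Unit →ₗ[k] M}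
    (h₁ : f (lhs₁ k) = g (lhs₁ k)) (h₂ : f (lhs₂ k) = g (lhs₂ k)) : f = g := by
  ext ⟨x, hx⟩
  induction hx using Submodule.span_induction with
  | zero => exact (map_zero f).trans (map_zero g).symm
  | add x y hx hy ihx ihy =>
    exact (map_add f ⟨x, hx⟩ ⟨y, hy⟩).trans
      ((congrArg₂ (· + ·) ihx ihy).trans (map_add g ⟨x, hx⟩ ⟨y, hy⟩).symm)
  | smul c x hx ih =>
    exact (map_smul f c ⟨x, hx⟩).trans
      ((congrArg (c • ·) ih).trans (map_smul g c ⟨x, hx⟩).symm)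
  | mem x hx =>
    obtain ⟨_, ⟨⟨⟩, rfl⟩, _, ⟨⟨⟩, rfl⟩, rfl | rfl⟩ := hx
    · exact h₁
    · exact h₂

open Classical in
/-- The coefficient of the concatenation in the product of two words. -/
def weight (e e' : k) : Op → List Op → List Op → k
  | .inl _, u, v => (if cir ∈ u then e else 1) * (if cir ∈ v then e' else 1)
  | .inr _, _, _ => 1

/-- The operations on the span of all words in the letters `•`, `∘`: up to a scalar, the words are
concatenated, with the letter of the operation in between. -/
def wordMul (e e' : k) (a : Op) : (List Op →₀ k) →ₗ[k] (List Op →₀ k) →ₗ[k] (List Op →₀ k) :=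
  Finsupp.linearCombination k fun u : List Op =>
    Finsupp.linearCombination k fun v : List Op => Finsupp.single (u ++ a :: v) (weight e e' a u v)

theorem wordMul_single (e e' : k) (a : Op) (u v : List Op) (c d : k) :
    wordMul e e' a (Finsupp.single u c) (Finsupp.single v d) =
      Finsupp.single (u ++ a :: v) (c * d * weight e e' a u v) := by
  simp [wordMul, mul_assoc, -Finsupp.single_mul]

/-- Both sides concatenate u, v, w with the letters b and a in between, so only the scalars have to
be compared. The factors r, r' let one statement serve the two associativities and the two rewrite
rules. -/
theorem wordMul_assoc (e e' : k) (a b : Op) (r r' : k)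
    (h : ∀ u v w, r * (weight e e' b u v * weight e e' a (u ++ b :: v) w) =
      r' * (weight e e' a v w * weight e e' b u (v ++ a :: w))) (x y z : List Op →₀ k) :
    r • wordMul e e' a (wordMul e e' b x y) z = r' • wordMul e e' b x (wordMul e e' a y z) := by
  induction x using Finsupp.induction_linear with
  | zero => simp
  | add x x' hx hx' => simp only [LinearMap.map_add₂, smul_add, hx, hx']
  | single u c =>
  induction y using Finsupp.induction_linear with
  | zero => simp
  | add y y' hy hy' => simp only [LinearMap.map_add₂, map_add (wordMul e e' b _),
      smul_add, hy, hy']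
  | single v c' =>
  induction z using Finsupp.induction_linear with
  | zero => simp
  | add z z' hz hz' => simp only [map_add, smul_add, hz, hz']
  | single w c'' =>
    rw [wordMul_single, wordMul_single, wordMul_single, wordMul_single, Finsupp.smul_single,
      Finsupp.smul_single, List.append_assoc, List.cons_append, smul_eq_mul, smul_eq_mul]
    congr 1
    linear_combination c * c' * c'' * h u v w

variable {e e' : k}

/-- Idempotency is essential: if only u contains ∘, then (u • v) • w collects e twice and u • (v •
w) once, and symmetrically for w and e'. -/
theorem wordMul_bul_bul (he : e * e = e) (he' : e' * e' = e') (x y z : List Op →₀ k) :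
    wordMul e e' bul (wordMul e e' bul x y) z = wordMul e e' bul x (wordMul e e' bul y z) := by
  have := wordMul_assoc e e' bul bul 1 1 (fun u v w => by
    simp only [weight, List.mem_append, List.mem_cons, reduceCtorEq, false_or]
    split_ifs <;> grind) x y z
  simpa using this

theorem wordMul_cir_cir (x y z : List Op →₀ k) :
    wordMul e e' cir (wordMul e e' cir x y) z = wordMul e e' cir x (wordMul e e' cir y z) := by
  have := wordMul_assoc e e' cir cir 1 1 (fun u v w => by simp [weight]) x y z
  simpa using this

theorem wordMul_bul_cir (he : e * e = e) (x y z : List Op →₀ k) :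
    wordMul e e' bul (wordMul e e' cir x y) z = e • wordMul e e' cir x (wordMul e e' bul y z) := by
  have := wordMul_assoc e e' bul cir 1 e (fun u v w => by
    simp only [weight, List.mem_append, List.mem_cons, true_or, or_true, if_true]
    split_ifs <;> grind) x y z
  simpa using this

theorem wordMul_cir_bul (he' : e' * e' = e') (x y z : List Op →₀ k) :
    wordMul e e' bul x (wordMul e e' cir y z) = e' • wordMul e e' cir (wordMul e e' bul x y) z := by
  have := wordMul_assoc e e' cir bul e' 1 (fun u v w => by
    simp only [weight, List.mem_append, List.mem_cons, true_or, or_true, if_true]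
    split_ifs <;> grind) x y z
  simpa using this.symm

theorem evalTotal_leftMon {A : Type v} [AddCommGroup A] [Module k A] {α : Type u}
    (B : α → A →ₗ[k] A →ₗ[k] A) (y : ℕ → A) (p q : α) :
    evalTotal B y (incl k 3 (leftMon k p q)) = B p (B q (y 0) (y 1)) (y 2) := by
  simp [leftMon, incl, evalTotal_single, leftTree, evalTree, BTree.leaves]

theorem evalTotal_rightMon {A : Type v} [AddCommGroup A] [Module k A] {α : Type u}
    (B : α → A →ₗ[k] A →ₗ[k] A) (y : ℕ → A) (p q : α) :
    evalTotal B y (incl k 3 (rightMon k p q)) = B p (y 0) (B q (y 1) (y 2)) := by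
  simp [rightMon, incl, evalTotal_single, rightTree, evalTree, BTree.leaves]

theorem freeMap_leftMon {α : Type u} {β : Type v} (f : α → β) (p q : α) :
    freeMap k f 3 (leftMon k p q) = leftMon k (f p) (f q) := by
  simp only [freeMap, leftMon, Finsupp.lmapDomain_apply, Finsupp.mapDomain_single]
  rfl

theorem freeMap_rightMon {α : Type u} {β : Type v} (f : α → β) (p q : α) :
    freeMap k f 3 (rightMon k p q) = rightMon k (f p) (f q) := by
  simp only [freeMap, rightMon, Finsupp.lmapDomain_apply, Finsupp.mapDomain_single]
  rfl

theorem map_assRel {β : Type v} (f : Unit → β) :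
    (assRel k).map (freeMap k f 3) =
      Submodule.span k {leftMon k (f ()) (f ()) - rightMon k (f ()) (f ())} := by
  rw [assRel, Submodule.map_span, Set.image_singleton, map_sub, freeMap_leftMon, freeMap_rightMon]

theorem IsScalarRule.combinedRel_le {D : Rule k} (he : e * e = e) (he' : e' * e' = e')
    (h : IsScalarRule D e e') :
    combinedRel (assRel k) (assRel k) D ≤ identities (wordMul e e') 3 := by
  refine sup_le (sup_le ?_ ?_) ?_
  · rw [map_assRel, Submodule.span_singleton_le_iff_mem, mem_identities]
    intro y
    rw [map_sub, map_sub, evalTotal_leftMon, evalTotal_rightMon, wordMul_bul_bul he he', sub_self]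
  -- The relations range over the whole space of left-hand sides; stated as an equality of linear
  -- maps, they reduce to the two generators.
  · have key : (identities (wordMul e e') 3).mkQ ∘ₗ (F12 k Unit Unit).subtype =
        (identities (wordMul e e') 3).mkQ ∘ₗ (F21 k Unit Unit).subtype ∘ₗ D := by
      apply F12_hom_ext
      · simp only [LinearMap.comp_apply, h.1, Submodule.mkQ_apply, Submodule.subtype_apply]
        rw [Submodule.Quotient.eq, mem_identities]
        intro y
        simp only [lhs₁, rhs₂, map_sub, map_smul, Submodule.coe_smul]
        rw [evalTotal_leftMon, evalTotal_rightMon, wordMul_bul_cir he, sub_self]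
      · simp only [LinearMap.comp_apply, h.2, Submodule.mkQ_apply, Submodule.subtype_apply]
        rw [Submodule.Quotient.eq, mem_identities]
        intro y
        simp only [lhs₂, rhs₁, map_sub, map_smul, Submodule.coe_smul]
        rw [evalTotal_leftMon, evalTotal_rightMon, wordMul_cir_bul he', sub_self]
    rw [ruleRel, Submodule.span_le]
    rintro _ ⟨x, rfl⟩
    exact (Submodule.Quotient.eq _).1 (LinearMap.congr_fun key x)
  · rw [map_assRel, Submodule.span_singleton_le_iff_mem, mem_identities]
    intro y
    rw [map_sub, map_sub, evalTotal_leftMon, evalTotal_rightMon, wordMul_cir_cir, sub_self]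

/-- A normal monomial with a given word of operations, starting from `s`. -/
def wordTree : List Op → BTree Op → BTree Op
  | [], s => s
  | .inl _ :: w, s => wordTree w (.node bul s .leaf)
  | .inr _ :: w, s => .node cir s (wordTree w .leaf)

theorem leaves_wordTree (w : List Op) (s : BTree Op) :
    (wordTree w s).leaves = w.length + s.leaves := by
  induction w generalizing s with
  | nil => simp [wordTree]
  | cons a w ih =>
    rcases a with _ | _ <;> simp [wordTree, ih, BTree.leaves] <;> omega

/-- No factor e or e' ever appears: a letter • multiplies the ∘-free word u by the empty word, and a
letter ∘ has weight 1 and starts the remaining word afresh. -/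
theorem evalTree_wordTree (w u : List Op) (hu : cir ∉ u) (s : BTree Op)
    (hs : evalTree (wordMul e e') s (fun _ => Finsupp.single [] 1) = Finsupp.single u 1) :
    evalTree (wordMul e e') (wordTree w s) (fun _ => Finsupp.single [] 1) =
      Finsupp.single (u ++ w) 1 := by
  induction w generalizing s u with
  | nil => simpa [wordTree] using hs
  | cons a w ih =>
    rcases a with ⟨⟩ | ⟨⟩
    · rw [wordTree, ih (u ++ [bul]) (by simpa using hu), List.append_assoc, List.singleton_append]
      rw [evalTree, hs, evalTree, wordMul_single]
      simp [weight, hu]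
    · rw [wordTree, evalTree, hs, ih [] (by simp) .leaf rfl, wordMul_single]
      simp [weight]

/-- The value of an operation of the quotient operad at copies of the generator of the algebra
of words. -/
def IsScalarRule.wordEval {D : Rule k} (he : e * e = e) (he' : e' * e' = e')
    (h : IsScalarRule D e e') (n : ℕ) :
    Operad (combinedRel (assRel k) (assRel k) D) n →ₗ[k] (List Op →₀ k) :=
  (ideal (combinedRel (assRel k) (assRel k) D) n).liftQ
    (evalTotal (wordMul e e') (fun _ => Finsupp.single [] 1) ∘ₗ incl k n)
    fun _ hx => LinearMap.mem_ker.2 <| (mem_identities _).1 (ideal_le_identities _ (h.combinedRel_le he he') n hx) _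

/-- The class of the normal monomial with word `w`. -/
def wordClass (S : Submodule k (Free k Op 3)) {n : ℕ} (hn : 1 ≤ n) (w : Fin (n - 1) → Op) :
    Operad S n :=
  Submodule.Quotient.mk (Finsupp.single ⟨wordTree (List.ofFn w) .leaf, by
    rw [leaves_wordTree, List.length_ofFn, BTree.leaves]; omega⟩ 1)

theorem IsScalarRule.wordEval_wordClass {D : Rule k} (he : e * e = e) (he' : e' * e' = e')
    (h : IsScalarRule D e e') {n : ℕ} (hn : 1 ≤ n) (w : Fin (n - 1) → Op) :
    h.wordEval he he' n (wordClass _ hn w) = Finsupp.single (List.ofFn w) 1 := by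
  refine (Submodule.liftQ_apply _ _ _).trans ?_
  rw [LinearMap.comp_apply, incl, Finsupp.lmapDomain_apply, Finsupp.mapDomain_single,
    evalTotal_single, one_smul]
  exact evalTree_wordTree (List.ofFn w) [] (by simp) .leaf rfl

end Model

/-! ### Dimension count: the scalar rules with idempotent coefficients are laws -/

section Law

variable {k : Type w} [Field k] {e e' : k}

/-- Evaluation in the word algebra sends the 2^(n-1) classes `wordClass` to distinct basis words. -/
theorem IsScalarRule.le_finrank {D : Rule k} (he : e * e = e) (he' : e' * e' = e')
    (h : IsScalarRule D e e') (n : ℕ) (hn : 1 ≤ n)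
    [Module.Finite k (Operad (combinedRel (assRel k) (assRel k) D) n)] :
    2 ^ (n - 1) ≤ Module.finrank k (Operad (combinedRel (assRel k) (assRel k) D) n) := by
  have hli : LinearIndependent k
      (wordClass (combinedRel (assRel k) (assRel k) D) hn : (Fin (n - 1) → Op) → _) := by
    refine LinearIndependent.of_comp (h.wordEval he he' n) ?_
    rw [show h.wordEval he he' n ∘ wordClass _ hn = (fun u => Finsupp.single u 1) ∘ List.ofFn from
      funext fun w => h.wordEval_wordClass he he' hn w]
    exact (Finsupp.linearIndependent_single_one k (List Op)).comp _ List.ofFn_injective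
  simpa using hli.fintype_card_le_finrank

theorem IsScalarRule.isAssAssLaw {D : Rule k} (he : e * e = e) (he' : e' * e' = e')
    (h : IsScalarRule D e e') : IsAssAssLaw D := by
  intro n hn
  have hn' : 1 ≤ n := by omega
  have hs := h.xi_surjective (R₁ := assRel k) (R₂ := assRel k) n
  have := finite_composite k n hn'
  have := Module.Finite.of_surjective _ hs
  have h1 := h.le_finrank he he' n hn'
  have h2 := LinearMap.finrank_le_finrank_of_surjective hs
  rw [finrank_composite k n hn'] at h2
  -- With the source replaced by a function space, surjectivity and equality of the finite
  -- dimensions give injectivity.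
  let g := xi (assRel k) (assRel k) D n ∘ₗ (compositeEquiv k n hn').symm.toLinearMap
  have hg : Function.Surjective g := hs.comp (compositeEquiv k n hn').symm.surjective
  have hr : Module.finrank k (Composition n → k) =
      Module.finrank k (Operad (combinedRel (assRel k) (assRel k) D) n) := by
    rw [Module.finrank_pi, composition_card]
    exact h1.antisymm h2
  have hg' := (LinearMap.injective_iff_surjective_of_finrank_eq_finrank hr).2 hg
  exact ⟨(Function.Injective.of_comp_iff' _ (compositeEquiv k n hn').symm.bijective).1 hg', hs⟩

end Law

/-! ### Specialising the indeterminates of [RR] -/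

section Naturality

variable {A : Type v} {B : Type w} [CommRing A] [CommRing B] (f : A →+* B) {α : Type u}

/-- Change of scalars for linear combinations of monomials. -/
def scalarMap : Total A α →+ Total B α := Finsupp.mapRange.addMonoidHom f.toAddMonoidHom

theorem scalarMap_apply (x : Total A α) (t : BTree α) : scalarMap f x t = f (x t) := rfl

theorem scalarMap_single (t : BTree α) (c : A) :
    scalarMap f (Finsupp.single t c) = Finsupp.single t (f c) := by
  simp [scalarMap]

theorem scalarMap_smul (c : A) (x : Total A α) : scalarMap f (c • x) = f c • scalarMap f x := by
  ext t
  simp [scalarMap_apply]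

theorem scalarMap_mul (a : α) (x y : Total A α) :
    scalarMap f (mul A a x y) = mul B a (scalarMap f x) (scalarMap f y) := by
  induction x using Finsupp.induction_linear with
  | zero => simp
  | add x x' hx hx' => rw [LinearMap.map_add₂, map_add, map_add, LinearMap.map_add₂, hx, hx']
  | single s b =>
  induction y using Finsupp.induction_linear with
  | zero => simp
  | add y y' hy hy' => simp only [map_add, hy, hy']
  | single t c => simp only [mul_single_single, scalarMap_single, map_mul]

theorem scalarMap_quadRel (a b c d : A) (i : Fin 4) (x y z : Total A Op) :
    scalarMap f (quadRel A a b c d i x y z) =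
      quadRel B (f a) (f b) (f c) (f d) i (scalarMap f x) (scalarMap f y) (scalarMap f z) := by
  fin_cases i <;> simp [quadRel, scalarMap_mul, scalarMap_smul]

theorem scalarMap_cubicConsequence {ρ : Total A Op → Total A Op → Total A Op → Total A Op}
    {ρ' : Total B Op → Total B Op → Total B Op → Total B Op}
    (h : ∀ x y z, scalarMap f (ρ x y z) = ρ' (scalarMap f x) (scalarMap f y) (scalarMap f z))
    (j : Fin 10) : scalarMap f (cubicConsequence A ρ j) = cubicConsequence B ρ' j := by
  fin_cases j <;> simp [cubicConsequence, h, scalarMap_mul, scalarMap_single]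

/-- The matrix of cubic consequences at `(a, b, c, d)`. -/
def cubicMatrixAt (a b c d : A) : Matrix (Fin 4 × Fin 10) (Fin 5 × Op × Op × Op) A :=
  fun i j => cubicConsequence A (quadRel A a b c d i.1) i.2
    (cubicMonomial j.2.1 j.2.2.1 j.2.2.2 j.1)

theorem cubicMatrix_map_eval (a b c d : A) :
    (cubicMatrix A).map (MvPolynomial.eval ![a, b, c, d]) = cubicMatrixAt a b c d := by
  ext i j
  change MvPolynomial.eval ![a, b, c, d] (cubicConsequence _ _ _ _) = _
  rw [← scalarMap_apply, scalarMap_cubicConsequence _ (scalarMap_quadRel _ _ _ _ _ i.1)]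
  simp [cubicMatrixAt]

end Naturality

/-! ### Elimination and overlaps in arity 4 -/

section Relations

variable {k : Type w} [CommRing k]

/-- The ten monomials of arity `4` obtained from a monomial `τ` of arity `3`. -/
def consequenceTree (τ : BTree Op → BTree Op → BTree Op → BTree Op) : Fin 10 → BTree Op :=
  let e : BTree Op := .leaf
  ![τ (.node cir e e) e e, τ (.node bul e e) e e, τ e (.node cir e e) e, τ e (.node bul e e) e,
    τ e e (.node cir e e), τ e e (.node bul e e), .node cir (τ e e e) e, .node bul (τ e e e) e,
    .node cir e (τ e e e), .node bul e (τ e e e)]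

/-- The monomial `(x q y) p z`. -/
def leftNode (p q : Op) (x y z : BTree Op) : BTree Op := .node p (.node q x y) z

/-- The monomial `x p (y q z)`. -/
def rightNode (p q : Op) (x y z : BTree Op) : BTree Op := .node p x (.node q y z)

variable {M : Type v} [AddCommGroup M] [Module k M] (q : Total k Op →ₗ[k] M) {a b c d : k}

/-- This lemma and the next three read the rows of [RR] as relations between images of monomials
under a linear map q that kills every row. -/
theorem consequence_zero (h : ∀ i j, q (cubicConsequence k (quadRel k a b c d i) j) = 0)
    (j : Fin 10) : q (Finsupp.single (consequenceTree (leftNode cir cir) j) 1) -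
      q (Finsupp.single (consequenceTree (rightNode cir cir) j) 1) = 0 := by
  rw [← h 0 j]
  fin_cases j <;>
    simp [cubicConsequence, quadRel, mul_single_single, consequenceTree, leftNode, rightNode]

theorem consequence_one (h : ∀ i j, q (cubicConsequence k (quadRel k a b c d i) j) = 0)
    (j : Fin 10) : q (Finsupp.single (consequenceTree (leftNode bul bul) j) 1) -
      q (Finsupp.single (consequenceTree (rightNode bul bul) j) 1) = 0 := by
  rw [← h 1 j]
  fin_cases j <;>
    simp [cubicConsequence, quadRel, mul_single_single, consequenceTree, leftNode, rightNode]

theorem consequence_two (h : ∀ i j, q (cubicConsequence k (quadRel k a b c d i) j) = 0)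
    (j : Fin 10) : q (Finsupp.single (consequenceTree (leftNode bul cir) j) 1) +
      a • q (Finsupp.single (consequenceTree (leftNode cir bul) j) 1) +
      b • q (Finsupp.single (consequenceTree (rightNode cir bul) j) 1) = 0 := by
  rw [← h 2 j]
  fin_cases j <;>
    simp [cubicConsequence, quadRel, mul_single_single, consequenceTree, leftNode, rightNode,
      -Finsupp.smul_single]

theorem consequence_three (h : ∀ i j, q (cubicConsequence k (quadRel k a b c d i) j) = 0)
    (j : Fin 10) : q (Finsupp.single (consequenceTree (rightNode bul cir) j) 1) +
      c • q (Finsupp.single (consequenceTree (leftNode cir bul) j) 1) +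
      d • q (Finsupp.single (consequenceTree (rightNode cir bul) j) 1) = 0 := by
  rw [← h 3 j]
  fin_cases j <;>
    simp [cubicConsequence, quadRel, mul_single_single, consequenceTree, leftNode, rightNode,
      -Finsupp.smul_single]

/-- The image of a monomial of arity `4`. -/
def monomialImage (i : Fin 5) (p r s : Op) : M := q (Finsupp.single (cubicMonomial p r s i) 1)

/-- The images of the normal monomials of arity `4`. -/
def normalImage : Fin 8 → M :=
  ![monomialImage q 4 bul bul bul, monomialImage q 1 bul bul cir, monomialImage q 4 cir bul bul,
    monomialImage q 2 bul cir bul, monomialImage q 2 bul cir cir, monomialImage q 3 cir bul cir,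
    monomialImage q 4 cir cir bul, monomialImage q 4 cir cir cir]

theorem mem_of_sub_eq_zero {U : Submodule k M} {x y : M} (h : x - y = 0) (hy : y ∈ U) : x ∈ U := by
  rwa [sub_eq_zero.1 h]

theorem mem_of_add_smul_eq_zero {U : Submodule k M} {r s : k} {x y z : M}
    (h : x + r • y + s • z = 0) (hy : y ∈ U) (hz : z ∈ U) : x ∈ U := by
  rw [add_assoc] at h
  rw [eq_neg_of_add_eq_zero_left h]
  exact neg_mem (add_mem (U.smul_mem r hy) (U.smul_mem s hz))

/-- Triangular elimination, valid for all a, b, c, d: each of the 32 non-normal monomials occurs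
with coefficient ±1 in a row whose other monomials have already been reached. -/
theorem monomialImage_mem_span
    (h : ∀ i j, q (cubicConsequence k (quadRel k a b c d i) j) = 0) (i : Fin 5) (p r s : Op) :
    monomialImage q i p r s ∈ Submodule.span k (Set.range (normalImage q)) := by
  set U := Submodule.span k (Set.range (normalImage q))
  have hn : ∀ l, normalImage q l ∈ U := fun l => Submodule.subset_span ⟨l, rfl⟩
  have r0 := consequence_zero q h
  have r1 := consequence_one q h
  have r2 := consequence_two q h
  have r3 := consequence_three q h
  have t4bbb : monomialImage q 4 bul bul bul ∈ U := hn 0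
  have t1bbc : monomialImage q 1 bul bul cir ∈ U := hn 1
  have t4cbb : monomialImage q 4 cir bul bul ∈ U := hn 2
  have t2bcb : monomialImage q 2 bul cir bul ∈ U := hn 3
  have t2bcc : monomialImage q 2 bul cir cir ∈ U := hn 4
  have t3cbc : monomialImage q 3 cir bul cir ∈ U := hn 5
  have t4ccb : monomialImage q 4 cir cir bul ∈ U := hn 6
  have t4ccc : monomialImage q 4 cir cir cir ∈ U := hn 7
  -- The relations preserve the number of ∘. The pure monomials come first, and associativity alone
  -- reduces them.
  have t2bbb : monomialImage q 2 bul bul bul ∈ U := mem_of_sub_eq_zero (r1 5) t4bbb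
  have t0bbb : monomialImage q 0 bul bul bul ∈ U := mem_of_sub_eq_zero (r1 1) t2bbb
  have t3bbb : monomialImage q 3 bul bul bul ∈ U := mem_of_sub_eq_zero (r1 9) t4bbb
  have t1bbb : monomialImage q 1 bul bul bul ∈ U := mem_of_sub_eq_zero (r1 3) t3bbb
  have t2ccc : monomialImage q 2 cir cir cir ∈ U := mem_of_sub_eq_zero (r0 4) t4ccc
  have t0ccc : monomialImage q 0 cir cir cir ∈ U := mem_of_sub_eq_zero (r0 0) t2ccc
  have t3ccc : monomialImage q 3 cir cir cir ∈ U := mem_of_sub_eq_zero (r0 8) t4ccc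
  have t1ccc : monomialImage q 1 cir cir cir ∈ U := mem_of_sub_eq_zero (r0 2) t3ccc
  -- Monomials with two • and one ∘.
  have t3cbb : monomialImage q 3 cir bul bul ∈ U := mem_of_sub_eq_zero (r1 8) t4cbb
  have t0bbc : monomialImage q 0 bul bul cir ∈ U := mem_of_sub_eq_zero (r1 6) t1bbc
  have t2bbc : monomialImage q 2 bul bul cir ∈ U := mem_of_add_smul_eq_zero (r3 1) t0bbc t2bcb
  have t3bbc : monomialImage q 3 bul bul cir ∈ U := mem_of_add_smul_eq_zero (r3 3) t1bbc t3cbb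
  have t4bcb : monomialImage q 4 bul cir bul ∈ U := mem_of_add_smul_eq_zero (r3 5) t2bcb t4cbb
  have t4bbc : monomialImage q 4 bul bul cir ∈ U := mem_of_add_smul_eq_zero (r3 9) t3bbc t4bcb
  have t0bcb : monomialImage q 0 bul cir bul ∈ U := mem_of_add_smul_eq_zero (r2 1) t0bbc t2bcb
  have t1cbb : monomialImage q 1 cir bul bul ∈ U := mem_of_add_smul_eq_zero (r2 3) t1bbc t3cbb
  have t1bcb : monomialImage q 1 bul cir bul ∈ U := mem_of_add_smul_eq_zero (r3 7) t0bcb t1cbb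
  have t3bcb : monomialImage q 3 bul cir bul ∈ U := mem_of_add_smul_eq_zero (r2 9) t3bbc t4bcb
  have t0cbb : monomialImage q 0 cir bul bul ∈ U := mem_of_add_smul_eq_zero (r2 7) t0bcb t1cbb
  have t2cbb : monomialImage q 2 cir bul bul ∈ U := mem_of_add_smul_eq_zero (r2 5) t2bcb t4cbb
  -- Monomials with one • and two ∘.
  have t0bcc : monomialImage q 0 bul cir cir ∈ U := mem_of_sub_eq_zero (r0 1) t2bcc
  have t1cbc : monomialImage q 1 cir bul cir ∈ U := mem_of_sub_eq_zero (r0 3) t3cbc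
  have t1bcc : monomialImage q 1 bul cir cir ∈ U := mem_of_add_smul_eq_zero (r3 6) t0bcc t1cbc
  have t3ccb : monomialImage q 3 cir cir bul ∈ U := mem_of_add_smul_eq_zero (r2 8) t3cbc t4ccb
  have t3bcc : monomialImage q 3 bul cir cir ∈ U := mem_of_add_smul_eq_zero (r3 2) t1bcc t3ccb
  have t4cbc : monomialImage q 4 cir bul cir ∈ U := mem_of_add_smul_eq_zero (r3 8) t3cbc t4ccb
  have t4bcc : monomialImage q 4 bul cir cir ∈ U := mem_of_add_smul_eq_zero (r3 4) t2bcc t4cbc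
  have t0cbc : monomialImage q 0 cir bul cir ∈ U := mem_of_add_smul_eq_zero (r2 6) t0bcc t1cbc
  have t2cbc : monomialImage q 2 cir bul cir ∈ U := mem_of_add_smul_eq_zero (r2 4) t2bcc t4cbc
  have t2ccb : monomialImage q 2 cir cir bul ∈ U := mem_of_sub_eq_zero (r0 5) t4ccb
  have t0ccb : monomialImage q 0 cir cir bul ∈ U := mem_of_add_smul_eq_zero (r2 0) t0cbc t2ccb
  have t1ccb : monomialImage q 1 cir cir bul ∈ U := mem_of_add_smul_eq_zero (r2 2) t1bcc t3ccb
  rcases p with ⟨⟩ | ⟨⟩ <;> rcases r with ⟨⟩ | ⟨⟩ <;> rcases s with ⟨⟩ | ⟨⟩ <;> fin_cases i <;>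
    assumption

/-- Overlap ((w ∘ x) ∘ y) • z: apply the rewrite rule at once, or reassociate ∘ first, and compare
the normal forms. -/
theorem ambiguity_cir_cir_bul
    (h : ∀ i j, q (cubicConsequence k (quadRel k a b c d i) j) = 0) :
    (a ^ 2 - a * c) • normalImage q 4 + (-a * d) • normalImage q 5 +
      (-b - b ^ 2) • normalImage q 6 = 0 := by
  have h1 : monomialImage q 0 cir cir bul - monomialImage q 1 cir cir bul = 0 :=
    consequence_zero q h 7
  have h2 : monomialImage q 0 cir cir bul + a • monomialImage q 0 cir bul cir +
    b • monomialImage q 2 cir cir bul = 0 := consequence_two q h 0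
  have h3 : monomialImage q 0 cir bul cir + a • monomialImage q 0 bul cir cir +
    b • monomialImage q 1 cir bul cir = 0 := consequence_two q h 6
  have h4 : monomialImage q 2 cir cir bul - normalImage q 6 = 0 := consequence_zero q h 5
  have h5 : monomialImage q 0 bul cir cir - normalImage q 4 = 0 := consequence_zero q h 1
  have h6 : monomialImage q 1 cir bul cir - normalImage q 5 = 0 := consequence_zero q h 3
  have h7 : monomialImage q 1 cir cir bul + a • monomialImage q 1 bul cir cir +
    b • monomialImage q 3 cir cir bul = 0 := consequence_two q h 2
  have h8 : monomialImage q 1 bul cir cir + c • monomialImage q 0 bul cir cir +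
    d • monomialImage q 1 cir bul cir = 0 := consequence_three q h 6
  have h9 : monomialImage q 3 cir cir bul + a • normalImage q 5 + b • normalImage q 6 = 0 :=
    consequence_two q h 8
  linear_combination (norm := module) h1 - h2 + a • h3 - (a ^ 2) • h5 - (a * b) • h6 + b • h4 + h7 -
    a • h8 + (a * c) • h5 + (a * d) • h6 - b • h9

/-- Overlap w • ((x ∘ y) ∘ z), again the rewrite rule against associativity of ∘. -/
theorem ambiguity_bul_cir_cir
    (h : ∀ i j, q (cubicConsequence k (quadRel k a b c d i) j) = 0) :
    (c ^ 2 + c) • normalImage q 4 + (a * d) • normalImage q 5 +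
      (b * d - d ^ 2) • normalImage q 6 = 0 := by
  have h1 : monomialImage q 3 bul cir cir - monomialImage q 4 bul cir cir = 0 :=
    consequence_zero q h 9
  have h2 : monomialImage q 3 bul cir cir + c • monomialImage q 1 bul cir cir +
    d • monomialImage q 3 cir cir bul = 0 := consequence_three q h 2
  have h3 : monomialImage q 1 bul cir cir + c • monomialImage q 0 bul cir cir +
    d • monomialImage q 1 cir bul cir = 0 := consequence_three q h 6
  have h5 : monomialImage q 0 bul cir cir - normalImage q 4 = 0 := consequence_zero q h 1
  have h6 : monomialImage q 1 cir bul cir - normalImage q 5 = 0 := consequence_zero q h 3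
  have h7 : monomialImage q 3 cir cir bul + a • normalImage q 5 + b • normalImage q 6 = 0 :=
    consequence_two q h 8
  have h8 : monomialImage q 4 bul cir cir + c • normalImage q 4 +
    d • monomialImage q 4 cir bul cir = 0 := consequence_three q h 4
  have h9 : monomialImage q 4 cir bul cir + c • normalImage q 5 + d • normalImage q 6 = 0 :=
    consequence_three q h 8
  linear_combination (norm := module) h1 - h2 + c • h3 - (c ^ 2) • h5 - (c * d) • h6 + d • h7 + h8 -
    d • h9

/-- Overlap ((w ∘ x) • y) • z, the rewrite rule against associativity of •. -/
theorem ambiguity_cir_bul_bul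
    (h : ∀ i j, q (cubicConsequence k (quadRel k a b c d i) j) = 0) :
    (a ^ 2 + a * b) • normalImage q 1 + (b ^ 2 + b) • normalImage q 2 +
      (a * b + a) • normalImage q 3 = 0 := by
  have h1 : monomialImage q 0 cir bul bul - monomialImage q 2 cir bul bul = 0 :=
    consequence_one q h 0
  have h2 : monomialImage q 0 cir bul bul + a • monomialImage q 0 bul cir bul +
    b • monomialImage q 1 cir bul bul = 0 := consequence_two q h 7
  have h3 : monomialImage q 0 bul cir bul + a • monomialImage q 0 bul bul cir +
    b • normalImage q 3 = 0 := consequence_two q h 1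
  have h4 : monomialImage q 0 bul bul cir - normalImage q 1 = 0 := consequence_one q h 6
  have h5 : monomialImage q 1 cir bul bul + a • normalImage q 1 +
    b • monomialImage q 3 cir bul bul = 0 := consequence_two q h 3
  have h6 : monomialImage q 3 cir bul bul - normalImage q 2 = 0 := consequence_one q h 8
  have h7 : monomialImage q 2 cir bul bul + a • normalImage q 3 + b • normalImage q 2 = 0 :=
    consequence_two q h 5
  linear_combination (norm := module) h1 - h2 + a • h3 - (a ^ 2) • h4 + b • h5 - (b ^ 2) • h6 + h7

/-- Overlap (w • x) • (y ∘ z), the rewrite rule against associativity of •. No further overlap has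
to be examined, because sufficiency is proved by the word model. -/
theorem ambiguity_bul_bul_cir
    (h : ∀ i j, q (cubicConsequence k (quadRel k a b c d i) j) = 0) :
    (-c - c ^ 2) • normalImage q 1 + (-(c * d) - d ^ 2) • normalImage q 2 +
      (-d - c * d) • normalImage q 3 = 0 := by
  have h1 : monomialImage q 2 bul bul cir - monomialImage q 4 bul bul cir = 0 :=
    consequence_one q h 4
  have h2 : monomialImage q 2 bul bul cir + c • monomialImage q 0 bul bul cir +
    d • normalImage q 3 = 0 := consequence_three q h 1
  have h3 : monomialImage q 4 bul bul cir + c • monomialImage q 3 bul bul cir +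
    d • monomialImage q 4 bul cir bul = 0 := consequence_three q h 9
  have h4 : monomialImage q 3 bul bul cir + c • normalImage q 1 +
    d • monomialImage q 3 cir bul bul = 0 := consequence_three q h 3
  have h5 : monomialImage q 4 bul cir bul + c • normalImage q 3 + d • normalImage q 2 = 0 :=
    consequence_three q h 5
  have h6 : monomialImage q 3 cir bul bul - normalImage q 2 = 0 := consequence_one q h 8
  have h7 : monomialImage q 0 bul bul cir - normalImage q 1 = 0 := consequence_one q h 6
  linear_combination (norm := module) h1 - h2 + c • h7 + h3 - c • h4 + (c * d) • h6 - d • h5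

end Relations

/-! ### Rank of [RR] and the equations for the parameters -/

section Rank

theorem cubicMonomial_injective :
    Function.Injective fun j : Fin 5 × Op × Op × Op => cubicMonomial j.2.1 j.2.2.1 j.2.2.2 j.1 := by
  rintro ⟨i, p, q, r⟩ ⟨i', p', q', r'⟩ h
  fin_cases i <;> fin_cases i' <;> simp_all [cubicMonomial]

theorem leaves_cubicMonomial (p q r : Op) (i : Fin 5) : (cubicMonomial p q r i).leaves = 4 := by
  fin_cases i <;> rfl

theorem leaves_eq_one {α : Type u} {t : BTree α} (h : t.leaves = 1) : t = .leaf := by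
  cases t with
  | leaf => rfl
  | node a s t =>
    have := s.leaves_pos
    have := t.leaves_pos
    simp only [BTree.leaves] at h
    omega

theorem leaves_eq_two {α : Type u} {t : BTree α} (h : t.leaves = 2) :
    ∃ a, t = .node a .leaf .leaf := by
  cases t with
  | leaf => simp [BTree.leaves] at h
  | node a s t =>
    have hs := s.leaves_pos
    have ht := t.leaves_pos
    simp only [BTree.leaves] at h
    obtain rfl := leaves_eq_one (t := s) (by omega)
    obtain rfl := leaves_eq_one (t := t) (by simp only [BTree.leaves] at h; omega)
    exact ⟨a, rfl⟩

theorem leaves_eq_three {α : Type u} {t : BTree α} (h : t.leaves = 3) :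
    ∃ p q, t = .node p (.node q .leaf .leaf) .leaf ∨ t = .node p .leaf (.node q .leaf .leaf) := by
  cases t with
  | leaf => simp [BTree.leaves] at h
  | node a s t =>
    have hs := s.leaves_pos
    have ht := t.leaves_pos
    simp only [BTree.leaves] at h
    obtain h1 | h1 : s.leaves = 1 ∨ s.leaves = 2 := by omega
    · obtain ⟨b, rfl⟩ := leaves_eq_two (t := t) (by omega)
      obtain rfl := leaves_eq_one h1
      exact ⟨a, b, Or.inr rfl⟩
    · obtain rfl := leaves_eq_one (t := t) (by omega)
      obtain ⟨b, rfl⟩ := leaves_eq_two h1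
      exact ⟨a, b, Or.inl rfl⟩

theorem exists_cubicMonomial {t : BTree Op} (h : t.leaves = 4) :
    ∃ i p q r, t = cubicMonomial p q r i := by
  cases t with
  | leaf => simp [BTree.leaves] at h
  | node a s t =>
    have hs := s.leaves_pos
    have ht := t.leaves_pos
    simp only [BTree.leaves] at h
    obtain h1 | h1 | h1 : s.leaves = 1 ∨ s.leaves = 2 ∨ s.leaves = 3 := by omega
    · obtain ⟨p, q, rfl | rfl⟩ := leaves_eq_three (t := t) (by omega)
      · obtain rfl := leaves_eq_one h1
        exact ⟨3, a, q, p, rfl⟩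
      · obtain rfl := leaves_eq_one h1
        exact ⟨4, a, p, q, rfl⟩
    · obtain ⟨q, rfl⟩ := leaves_eq_two (t := t) (by omega)
      obtain ⟨p, rfl⟩ := leaves_eq_two h1
      exact ⟨2, p, a, q, rfl⟩
    · obtain rfl := leaves_eq_one (t := t) (by omega)
      obtain ⟨p, q, rfl | rfl⟩ := leaves_eq_three h1
      · exact ⟨0, q, p, a, rfl⟩
      · exact ⟨1, p, q, a, rfl⟩

variable {k : Type w} [Field k]

/-- The coordinates with respect to the monomials of arity `4`. -/
def cubicCoords (k : Type w) [Field k] : Total k Op →ₗ[k] (Fin 5 × Op × Op × Op → k) :=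
  LinearMap.pi fun j => Finsupp.lapply (cubicMonomial j.2.1 j.2.2.1 j.2.2.2 j.1)

theorem cubicCoords_single (j : Fin 5 × Op × Op × Op) :
    cubicCoords k (Finsupp.single (cubicMonomial j.2.1 j.2.2.1 j.2.2.2 j.1) 1) =
      Pi.single j 1 := by
  classical
  ext j'
  simp only [cubicCoords, LinearMap.pi_apply, Finsupp.lapply_apply, Finsupp.single_apply,
    Pi.single_apply]
  exact if_congr (cubicMonomial_injective.eq_iff.trans eq_comm) rfl rfl

theorem cubicMatrixAt_row (a b c d : k) (i : Fin 4 × Fin 10) :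
    (cubicMatrixAt a b c d).row i =
      cubicCoords k (cubicConsequence k (quadRel k a b c d i.1) i.2) := rfl

/-- The space spanned by the cubic consequences. -/
def rowSpace (a b c d : k) : Submodule k (Fin 5 × Op × Op × Op → k) :=
  Submodule.span k (Set.range (cubicMatrixAt a b c d).row)

/-- The projection to the quotient by the cubic consequences. -/
def quarticQuotient (a b c d : k) :
    Total k Op →ₗ[k] (Fin 5 × Op × Op × Op → k) ⧸ rowSpace a b c d :=
  (rowSpace a b c d).mkQ ∘ₗ cubicCoords k

theorem quarticQuotient_consequence (a b c d : k) (i : Fin 4) (j : Fin 10) :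
    quarticQuotient a b c d (cubicConsequence k (quadRel k a b c d i) j) = 0 :=
  (Submodule.Quotient.mk_eq_zero _).2 (Submodule.subset_span ⟨(i, j), rfl⟩)

theorem span_normalImage (a b c d : k) :
    ⊤ ≤ Submodule.span k (Set.range (normalImage (quarticQuotient a b c d))) := by
  rintro x -
  obtain ⟨x, rfl⟩ := Submodule.Quotient.mk_surjective _ x
  rw [← Submodule.mkQ_apply, ← (Pi.basisFun k _).sum_repr x, map_sum]
  refine sum_mem fun j _ => ?_
  rw [map_smul, Pi.basisFun_apply, ← cubicCoords_single]
  exact Submodule.smul_mem _ _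
    (monomialImage_mem_span _ (quarticQuotient_consequence a b c d) _ _ _ _)

theorem rank_add_finrank (a b c d : k) :
    (cubicMatrixAt a b c d).rank +
      Module.finrank k ((Fin 5 × Op × Op × Op → k) ⧸ rowSpace a b c d) = 40 := by
  rw [Matrix.rank_eq_finrank_span_row, add_comm]
  refine (Submodule.finrank_quotient_add_finrank (rowSpace a b c d)).trans ?_
  simp

/-- Eight vectors span the quotient of the 40-dimensional space by the rows. -/
theorem le_rank (a b c d : k) : 32 ≤ (cubicMatrixAt a b c d).rank := by
  have h := rank_add_finrank a b c d
  have h' := finrank_le_of_span_eq_top (top_le_iff.1 (span_normalImage a b c d))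
  rw [Fintype.card_fin] at h'
  omega

/-- At rank 32 the quotient has dimension exactly 8, so its eight spanning vectors form a basis. -/
theorem linearIndependent_normalImage {a b c d : k} (h : (cubicMatrixAt a b c d).rank = 32) :
    LinearIndependent k (normalImage (quarticQuotient a b c d)) := by
  refine linearIndependent_of_top_le_span_of_card_eq_finrank (span_normalImage a b c d) ?_
  have := rank_add_finrank a b c d
  rw [Fintype.card_fin]
  omega

theorem parameters_of_linearIndependent [CharZero k] {M : Type v} [AddCommGroup M] [Module k M]
    (q : Total k Op →ₗ[k] M) {a b c d : k}
    (hr : ∀ i j, q (cubicConsequence k (quadRel k a b c d i) j) = 0)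
    (h : LinearIndependent k (normalImage q)) :
    a = 0 ∧ d = 0 ∧ (b = 0 ∨ b = -1) ∧ (c = 0 ∨ c = -1) := by
  have hli := Fintype.linearIndependent_iff.1 h
  have h1 := hli ![0, 0, 0, 0, a ^ 2 - a * c, -a * d, -b - b ^ 2, 0] (by
    simpa [Fin.sum_univ_eight] using ambiguity_cir_cir_bul _ hr)
  have h2 := hli ![0, 0, 0, 0, c ^ 2 + c, a * d, b * d - d ^ 2, 0] (by
    simpa [Fin.sum_univ_eight] using ambiguity_bul_cir_cir _ hr)
  have h3 := hli ![0, a ^ 2 + a * b, b ^ 2 + b, a * b + a, 0, 0, 0, 0] (by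
    simpa [Fin.sum_univ_eight] using ambiguity_cir_bul_bul _ hr)
  have h4 := hli ![0, -c - c ^ 2, -(c * d) - d ^ 2, -d - c * d, 0, 0, 0, 0] (by
    simpa [Fin.sum_univ_eight] using ambiguity_bul_bul_cir _ hr)
  have e1 : a ^ 2 - a * c = 0 := h1 4
  have e2 : -b - b ^ 2 = 0 := h1 6
  have e3 : c ^ 2 + c = 0 := h2 4
  have e4 : b * d - d ^ 2 = 0 := h2 6
  have e5 : a ^ 2 + a * b = 0 := h3 1
  have e6 : a * b + a = 0 := h3 3
  have e7 : -(c * d) - d ^ 2 = 0 := h4 2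
  have e8 : -d - c * d = 0 := h4 3
  -- From ab = -a and a² = -ab one gets a² = a, so ac = a² = a and ac² = a; but c² = -c gives ac² =
  -- -ac = -a. The argument for d is the same with b in place of c. This is where characteristic 0
  -- enters.
  have ha : 2 * a = 0 := by grind
  have hd : 2 * d = 0 := by grind
  refine ⟨by simpa using ha, by simpa using hd, ?_, ?_⟩
  · rw [← add_eq_zero_iff_eq_neg, ← mul_eq_zero]
    linear_combination -e2
  · rw [← add_eq_zero_iff_eq_neg, ← mul_eq_zero]
    linear_combination e3

theorem parameters_of_rank [CharZero k] {a b c d : k} (h : (cubicMatrixAt a b c d).rank = 32) :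
    a = 0 ∧ d = 0 ∧ (b = 0 ∨ b = -1) ∧ (c = 0 ∨ c = -1) :=
  parameters_of_linearIndependent _ (quarticQuotient_consequence a b c d)
    (linearIndependent_normalImage h)

end Rank

/-! ### Laws, rank 32 and the list of four rules -/

section LawRank

variable {k : Type w} [Field k]

/-- `D` is the rewrite rule with coefficients `a, b, c, d`. -/
def HasCoeffs (D : Rule k) (a b c d : k) : Prop :=
  D (lhs₁ k) = -(a • rhs₁ k) - b • rhs₂ k ∧ D (lhs₂ k) = -(c • rhs₁ k) - d • rhs₂ k

theorem exists_coeffs_of_mem (x : F21 k Unit Unit) : ∃ a b : k, x = -(a • rhs₁ k) - b • rhs₂ k := by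
  obtain ⟨x, hx⟩ := x
  have : x ∈ Submodule.span k {leftMon k cir bul, rightMon k cir bul} := by
    refine Submodule.span_mono ?_ hx
    rintro _ ⟨_, ⟨⟨⟩, rfl⟩, _, ⟨⟨⟩, rfl⟩, rfl | rfl⟩ <;> simp
  obtain ⟨a, b, rfl⟩ := Submodule.mem_span_pair.1 this
  exact ⟨-a, -b, Subtype.ext (by simp [rhs₁, rhs₂])⟩

theorem exists_hasCoeffs (D : Rule k) : ∃ a b c d, HasCoeffs D a b c d := by
  obtain ⟨a, b, h⟩ := exists_coeffs_of_mem (D (lhs₁ k))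
  obtain ⟨c, d, h'⟩ := exists_coeffs_of_mem (D (lhs₂ k))
  exact ⟨a, b, c, d, h, h'⟩

theorem bul_assoc_mem_combinedRel (D : Rule k) :
    leftMon k bul bul - rightMon k bul bul ∈ combinedRel (assRel k) (assRel k) D := by
  refine Submodule.mem_sup_left (Submodule.mem_sup_left ?_)
  rw [map_assRel]
  exact Submodule.mem_span_singleton_self _

theorem cir_assoc_mem_combinedRel (D : Rule k) :
    leftMon k cir cir - rightMon k cir cir ∈ combinedRel (assRel k) (assRel k) D := by
  refine Submodule.mem_sup_right ?_
  rw [map_assRel]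
  exact Submodule.mem_span_singleton_self _

theorem HasCoeffs.quadRel_mem {D : Rule k} {a b c d : k} (h : HasCoeffs D a b c d) (i : Fin 4)
    (x y z : Total k Op) :
    quadRel k a b c d i x y z ∈ totalIdeal (combinedRel (assRel k) (assRel k) D) := by
  have key : ∀ r ∈ combinedRel (assRel k) (assRel k) D, substFree 3 r ![x, y, z] ∈
      totalIdeal (combinedRel (assRel k) (assRel k) D) := fun r hr =>
    substFree_mem_totalIdeal (le_ideal _ hr) _
  have h0 := key _ (cir_assoc_mem_combinedRel D)
  have h1 := key _ (bul_assoc_mem_combinedRel D)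
  have h2 := key _ (sub_mem_combinedRel (assRel k) (assRel k) D (lhs₁ k))
  have h3 := key _ (sub_mem_combinedRel (assRel k) (assRel k) D (lhs₂ k))
  rw [h.1] at h2
  rw [h.2] at h3
  simp only [lhs₁, lhs₂, rhs₁, rhs₂, Submodule.coe_sub, Submodule.coe_neg, Submodule.coe_smul,
    map_sub, map_neg, map_smul, sub_apply, neg_apply, smul_apply,
    substFree_leftMon, substFree_rightMon] at h0 h1 h2 h3
  fin_cases i
  · exact h0
  · exact h1
  · convert h2 using 1
    simp only [quadRel]
    simp
    abel
  · convert h3 using 1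
    simp only [quadRel]
    simp
    abel

theorem cubicConsequence_mem {S : Submodule k (Free k Op 3)}
    {ρ : Total k Op → Total k Op → Total k Op → Total k Op}
    (h : ∀ x y z, ρ x y z ∈ totalIdeal S) (j : Fin 10) :
    cubicConsequence k ρ j ∈ totalIdeal S := by
  fin_cases j
  iterate 6 exact h _ _ _
  iterate 2 exact mul_mem_totalIdeal_left _ (h _ _ _) _
  iterate 2 exact mul_mem_totalIdeal_right _ _ (h _ _ _)

/-- The coordinates see only monomials with four leaves, so rows of [RR] may be replaced by their
arity 4 components, where the operad ideal lives. -/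
theorem cubicCoords_eq (x : Total k Op) :
    cubicCoords k x = cubicCoords k (incl k 4 (proj k 4 x)) := by
  induction x using Finsupp.induction_linear with
  | zero => simp
  | add x y hx hy => simp only [map_add, ← hx, ← hy]
  | single t c =>
    by_cases ht : t.leaves = 4
    · simp [proj_single, ht, incl]
    · rw [proj_single, dif_neg ht, map_zero, map_zero]
      ext j
      refine Finsupp.single_eq_of_ne ?_
      rintro rfl
      exact ht (leaves_cubicMonomial _ _ _ _)

theorem finrank_free_four :
    Module.Finite k (Free k Op 4) ∧ Module.finrank k (Free k Op 4) ≤ 40 := by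
  let f : Fin 5 × Op × Op × Op → TreeN Op 4 := fun j =>
    ⟨cubicMonomial j.2.1 j.2.2.1 j.2.2.2 j.1, leaves_cubicMonomial _ _ _ _⟩
  have hf : Function.Surjective f := by
    rintro ⟨t, ht⟩
    obtain ⟨i, p, q, r, rfl⟩ := exists_cubicMonomial ht
    exact ⟨(i, p, q, r), rfl⟩
  have := Finite.of_surjective f hf
  have := Fintype.ofFinite (TreeN Op 4)
  refine ⟨inferInstance, ?_⟩
  rw [Module.finrank_finsupp_self]
  simpa using Fintype.card_le_of_surjective f hf

/-- Bijectivity of ξ(4) gives dim P(4) = 8, so the arity 4 component of the ideal has dimension at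
most 40 - 8 = 32, and the rows lie in its image under the coordinate map. -/
theorem HasCoeffs.rank_eq {D : Rule k} {a b c d : k} (h : HasCoeffs D a b c d)
    (hD : IsAssAssLaw D) : (cubicMatrixAt a b c d).rank = 32 := by
  refine le_antisymm ?_ (le_rank a b c d)
  obtain ⟨hfin, h40⟩ := finrank_free_four (k := k)
  let I := ideal (combinedRel (assRel k) (assRel k) D) 4
  have h8 : Module.finrank k (Operad (combinedRel (assRel k) (assRel k) D) 4) = 8 :=
    (LinearEquiv.ofBijective (xi (assRel k) (assRel k) D 4)
      (hD 4 (by norm_num))).finrank_eq.symm.trans (finrank_composite k 4 (by norm_num))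
  have hI : Module.finrank k (Operad (combinedRel (assRel k) (assRel k) D) 4) +
      Module.finrank k I = Module.finrank k (Free k Op 4) :=
    Submodule.finrank_quotient_add_finrank I
  have hle : rowSpace a b c d ≤ I.map (cubicCoords k ∘ₗ incl k 4) := by
    rw [rowSpace, Submodule.span_le]
    rintro _ ⟨i, rfl⟩
    rw [cubicMatrixAt_row, cubicCoords_eq]
    exact ⟨_, proj_mem_ideal (cubicConsequence_mem (h.quadRel_mem i.1) i.2) 4, rfl⟩
  have h1 := Submodule.finrank_mono hle
  have h2 : Module.finrank k (I.map (cubicCoords k ∘ₗ incl k 4)) ≤ Module.finrank k I :=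
    Submodule.finrank_map_le _ _
  have h3 : (cubicMatrixAt a b c d).rank = Module.finrank k (rowSpace a b c d) :=
    Matrix.rank_eq_finrank_span_row _
  omega

/-- The four rewrite rules. -/
def IsOneOfFour (D : Rule k) : Prop :=
  (D (lhs₁ k) = 0 ∧ D (lhs₂ k) = 0) ∨
  (D (lhs₁ k) = 0 ∧ D (lhs₂ k) = rhs₁ k) ∨
  (D (lhs₁ k) = rhs₂ k ∧ D (lhs₂ k) = 0) ∨
  (D (lhs₁ k) = rhs₂ k ∧ D (lhs₂ k) = rhs₁ k)

theorem HasCoeffs.isOneOfFour [CharZero k] {D : Rule k} {a b c d : k} (h : HasCoeffs D a b c d)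
    (hr : (cubicMatrixAt a b c d).rank = 32) : IsOneOfFour D := by
  obtain ⟨rfl, rfl, hb, hc⟩ := parameters_of_rank hr
  obtain ⟨h1, h2⟩ := h
  have e0 : ∀ x y : F21 k Unit Unit, -((0 : k) • x) - (0 : k) • y = 0 := fun x y => by module
  have e1 : ∀ x y : F21 k Unit Unit, -((0 : k) • x) - (-1 : k) • y = y := fun x y => by module
  have e2 : ∀ x y : F21 k Unit Unit, -((-1 : k) • x) - (0 : k) • y = x := fun x y => by module
  rcases hb with rfl | rfl <;> rcases hc with rfl | rfl
  · exact Or.inl ⟨h1.trans (e0 _ _), h2.trans (e0 _ _)⟩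
  · exact Or.inr (Or.inl ⟨h1.trans (e0 _ _), h2.trans (e2 _ _)⟩)
  · exact Or.inr (Or.inr (Or.inl ⟨h1.trans (e1 _ _), h2.trans (e0 _ _)⟩))
  · exact Or.inr (Or.inr (Or.inr ⟨h1.trans (e1 _ _), h2.trans (e2 _ _)⟩))

theorem IsOneOfFour.isAssAssLaw {D : Rule k} (h : IsOneOfFour D) : IsAssAssLaw D := by
  rcases h with h | h | h | h
  · exact IsScalarRule.isAssAssLaw (e := 0) (e' := 0) (by simp) (by simp) (by simpa [IsScalarRule])
  · exact IsScalarRule.isAssAssLaw (e := 0) (e' := 1) (by simp) (by simp) (by simpa [IsScalarRule])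
  · exact IsScalarRule.isAssAssLaw (e := 1) (e' := 0) (by simp) (by simp) (by simpa [IsScalarRule])
  · exact IsScalarRule.isAssAssLaw (e := 1) (e' := 1) (by simp) (by simp) (by simpa [IsScalarRule])

/-- Every rule has coefficients a, b, c, d, so the rank criterion links the two sides. -/
theorem isAssAssLaw_iff [CharZero k] (D : Rule k) : IsAssAssLaw D ↔ IsOneOfFour D := by
  obtain ⟨a, b, c, d, h⟩ := exists_hasCoeffs D
  exact ⟨fun hD => h.isOneOfFour (h.rank_eq hD), fun hD => hD.isAssAssLaw⟩

/-- The rule `(x ∘ y) • z = r`, `x • (y ∘ z) = r'`. -/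
def ruleOf (r r' : F21 k Unit Unit) : Rule k :=
  (LinearMap.toSpanSingleton k _ r ∘ₗ Finsupp.lapply (leftTree bul cir) +
    LinearMap.toSpanSingleton k _ r' ∘ₗ Finsupp.lapply (rightTree bul cir)) ∘ₗ
      (F12 k Unit Unit).subtype

theorem leftTree_ne_rightTree (p q p' q' : Op) : leftTree p q ≠ rightTree p' q' := by
  intro h
  have h' : BTree.node p (.node q .leaf .leaf) .leaf =
      BTree.node p' .leaf (.node q' .leaf .leaf) := congrArg Subtype.val h
  simp at h'

theorem ruleOf_lhs₁ (r r' : F21 k Unit Unit) : ruleOf r r' (lhs₁ k) = r := by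
  simp [ruleOf, lhs₁, leftMon, (leftTree_ne_rightTree _ _ _ _).symm]

theorem ruleOf_lhs₂ (r r' : F21 k Unit Unit) : ruleOf r r' (lhs₂ k) = r' := by
  simp [ruleOf, lhs₂, rightMon, leftTree_ne_rightTree]

theorem eq_ruleOf_iff {D : Rule k} {r r' : F21 k Unit Unit} :
    D = ruleOf r r' ↔ D (lhs₁ k) = r ∧ D (lhs₂ k) = r' := by
  constructor
  · rintro rfl
    exact ⟨ruleOf_lhs₁ r r', ruleOf_lhs₂ r r'⟩
  · rintro ⟨h, h'⟩
    apply F12_hom_ext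
    · exact h.trans (ruleOf_lhs₁ r r').symm
    · exact h'.trans (ruleOf_lhs₂ r r').symm

theorem rhs₁_ne_zero : rhs₁ k ≠ 0 := by
  simp [rhs₁, leftMon, Subtype.ext_iff]

theorem rhs₂_ne_zero : rhs₂ k ≠ 0 := by
  simp [rhs₂, rightMon, Subtype.ext_iff]

theorem ncard_isAssAssLaw [CharZero k] : {D : Rule k | IsAssAssLaw D}.ncard = 4 := by
  have hinj : Function.Injective fun p : F21 k Unit Unit × F21 k Unit Unit =>
      ruleOf p.1 p.2 := by
    rintro ⟨r, r'⟩ ⟨s, s'⟩ h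
    obtain ⟨h1, h2⟩ := eq_ruleOf_iff.1 h
    rw [ruleOf_lhs₁] at h1
    rw [ruleOf_lhs₂] at h2
    exact Prod.ext h1 h2
  -- The two values of D are chosen independently, each from a set with two elements, which gives 2
  -- · 2 laws.
  have hset : {D : Rule k | IsAssAssLaw D} =
      (fun p : F21 k Unit Unit × F21 k Unit Unit => ruleOf p.1 p.2) ''
        ({0, rhs₂ k} ×ˢ {0, rhs₁ k}) := by
    ext D
    simp only [Set.mem_ofPred_eq, isAssAssLaw_iff, IsOneOfFour, ← eq_ruleOf_iff, Set.mem_image,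
      Prod.exists, Set.mem_prod, Set.mem_insert_iff, Set.mem_singleton_iff]
    constructor
    · rintro (rfl | rfl | rfl | rfl)
      · exact ⟨_, _, ⟨Or.inl rfl, Or.inl rfl⟩, rfl⟩
      · exact ⟨_, _, ⟨Or.inl rfl, Or.inr rfl⟩, rfl⟩
      · exact ⟨_, _, ⟨Or.inr rfl, Or.inl rfl⟩, rfl⟩
      · exact ⟨_, _, ⟨Or.inr rfl, Or.inr rfl⟩, rfl⟩
    · rintro ⟨r, r', ⟨rfl | rfl, rfl | rfl⟩, rfl⟩ <;> simp
  rw [hset, Set.ncard_image_of_injective _ hinj, Set.ncard_prod,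
    Set.ncard_pair rhs₂_ne_zero.symm, Set.ncard_pair rhs₁_ne_zero.symm]

end LawRank

end NSOp

end

theorem mainTheorem3 (k : Type*) [Field k] [CharZero k] :
    (∀ D : NSOp.Rule k, NSOp.IsAssAssLaw D ↔
      (D (NSOp.lhs₁ k) = 0 ∧ D (NSOp.lhs₂ k) = 0) ∨
      (D (NSOp.lhs₁ k) = 0 ∧ D (NSOp.lhs₂ k) = NSOp.rhs₁ k) ∨
      (D (NSOp.lhs₁ k) = NSOp.rhs₂ k ∧ D (NSOp.lhs₂ k) = 0) ∨
      (D (NSOp.lhs₁ k) = NSOp.rhs₂ k ∧ D (NSOp.lhs₂ k) = NSOp.rhs₁ k)) ∧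
    {D : NSOp.Rule k | NSOp.IsAssAssLaw D}.ncard = 4 ∧
    (∀ (a b c d : k) (D : NSOp.Rule k),
      D (NSOp.lhs₁ k) = -(a • NSOp.rhs₁ k) - b • NSOp.rhs₂ k →
      D (NSOp.lhs₂ k) = -(c • NSOp.rhs₁ k) - d • NSOp.rhs₂ k →
      (NSOp.IsAssAssLaw D ↔
        ((NSOp.cubicMatrix k).map (MvPolynomial.eval ![a, b, c, d])).rank = 32)) := by
  refine ⟨NSOp.isAssAssLaw_iff, NSOp.ncard_isAssAssLaw, fun a b c d D h₁ h₂ => ?_⟩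
  have h : NSOp.HasCoeffs D a b c d := ⟨h₁, h₂⟩
  rw [NSOp.cubicMatrix_map_eval]
  exact ⟨h.rank_eq, fun hr => (h.isOneOfFour hr).isAssAssLaw⟩
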